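/- Let $R$ be a commutative Noetherian ring, let $\mathfrak a$ be an ideal of $R$, let $X$ be an arbitrary $R$-module, and let $\mathcal S$ be a Serre subcategory of the category of $R$-modules, i.e. a class of $R$-modules containing $0$ such that for every short exact sequence $0\to M'\to M\to M''\to 0$ the module $M$ is in $\mathcal S$ if and only if both $M'$ and $M''$ are in $\mathcal S$. Denote by $H^i_{\mathfrak a}(X)=\varinjlim_t \operatorname{Ext}^i_R(R/\mathfrak a^t,X)$ the $i$-th local cohomology module of $X$ with respect to $\mathfrak a$. Let $n\ge 0$ be an integer such that $H^i_{\mathfrak a}(X)$ is in $\mathcal S$ for all $i>n$. Let $N$ be a finitely generated $R$-module that is $\mathfrak a$-torsion (every element of $N$ is annihilated by some power of $\mathfrak a$), and let $\mathfrak b$ be an ideal of $R$ with $\mathfrak a\subseteq\sqrt{\mathfrak b}$. Then the following hold. (i) If $n>0$, then $N\otimes_R H^n_{\mathfrak a}(X)$ is in $\mathcal S$. In particular, $H^n_{\mathfrak a}(X)/\mathfrak b H^n_{\mathfrak a}(X)$ is in $\mathcal S$. (ii) If $n>1$, then $\operatorname{Tor}^R_1(N,H^n_{\mathfrak a}(X))$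 is in $\mathcal S$. In particular, $\operatorname{Tor}^R_1(R/\mathfrak b,H^n_{\mathfrak a}(X))$ is in $\mathcal S$. -/

import Mathlib

open CategoryTheory
open scoped TensorProduct

universe u

/-- An `R`-module `M` is `𝔞`-torsion if every element of `M` is annihilated by some power of `𝔞`,
that is, if `Γ_𝔞(M) = M`. -/
def IsIdealTorsion {R : Type*} [CommRing R] (𝔞 : Ideal R) (M : Type*) [AddCommGroup M]
    [Module R M] : Prop :=
  ∀ x : M, ∃ k : ℕ, ∀ r ∈ 𝔞 ^ k, r • x = 0

/-! Write H^i for local cohomology at I = 𝔞, Γ for I-torsion, and M̄ = M/Γ(M). Embed X in an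
injective E with quotient Y. Dimension shifting, H^{i+1}(X) ≅ H^i(Y) for i ≥ 1, reduces everything
to degree one, where H^1(X) is the cokernel of Γ(E) → Γ(Y). The kernel Z of Ē → Ȳ then sits in 0 →
X̄ → Z → H^1(X) → 0.

Let K be the Koszul complex on generators of I^t. Over a Noetherian ring Ē is again injective and
has no nonzero element killed by I^t. Koszul homology is killed by I^t, so that of Ē vanishes in
every degree, and H_k(K ⊗ Z) is controlled by H_{k+1}(K ⊗ Ȳ). If all H^i(Y) with i ≥ 1 lie in the
Serre class, so does H_k(K ⊗ Ȳ): passing to further cosyzygies raises k until it exceeds the length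
of K (`serre_koszul_of_localCohomology`). Hence H_0 and H_1 of K ⊗ Z lie in the class. The first
gives H/I^tH for H = H^1(X). The second gives H_1(K ⊗ H) as soon as H_0(K ⊗ X̄) is in the class;
when n > 1, this group vanishes, because X has by then been replaced by a quotient of an injective
(`serre_of_localCohomology`).

Finally, N is killed by some I^t = c. So N ⊗ H is a quotient of a finite power of H/cH, and Tor_1(N,
H) is built from quotients of such powers and from Tor_1(R/c, H) = ker(c ⊗ H → H), itself a quotient
of H_1(K ⊗ H) (`serre_tensorKer_of_basis`, `serre_tensorKer_of_koszul`). -/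

namespace CategoryTheory

open Limits

/-! ### Connecting maps of left derived functors for an exact sequence of functors -/

section LeftDerivedSequence

variable {C D : Type*} [Category* C] [Category* D] [Abelian C]
  [Abelian D] {F G H : C ⥤ D} [F.Additive] [G.Additive] [H.Additive]

/-- A sequence `F ⟶ G ⟶ H` of natural transformations which is short exact on projectives. -/
structure ShortExactOnProjectives (α : F ⟶ G) (β : G ⟶ H) : Prop where
  zero : ∀ X, α.app X ≫ β.app X = 0
  shortExact : ∀ (P : C) [Projective P], (ShortComplex.mk (α.app P) (β.app P) (zero P)).ShortExact

namespace ShortExactOnProjectives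

variable {α : F ⟶ G} {β : G ⟶ H} (h : ShortExactOnProjectives α β)

/-- The short complex of chain complexes obtained by applying `F ⟶ G ⟶ H` to a chain complex. -/
@[simps]
noncomputable def shortComplex (K : ChainComplex C ℕ) : ShortComplex (ChainComplex D ℕ) where
  X₁ := (F.mapHomologicalComplex _).obj K
  X₂ := (G.mapHomologicalComplex _).obj K
  X₃ := (H.mapHomologicalComplex _).obj K
  f := (NatTrans.mapHomologicalComplex α _).app K
  g := (NatTrans.mapHomologicalComplex β _).app K
  zero := by
    ext i
    exact h.zero (K.X i)

include h in
lemma shortComplex_shortExact {K : ChainComplex C ℕ} (hK : ∀ i, Projective (K.X i)) :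
    (h.shortComplex K).ShortExact :=
  HomologicalComplex.shortExact_of_degreewise_shortExact _ fun i =>
    have := hK i
    h.shortExact (K.X i)

/-- Functoriality of `shortComplex`. -/
@[simps]
noncomputable def shortComplexMap {K L : ChainComplex C ℕ} (φ : K ⟶ L) :
    h.shortComplex K ⟶ h.shortComplex L where
  τ₁ := (F.mapHomologicalComplex _).map φ
  τ₂ := (G.mapHomologicalComplex _).map φ
  τ₃ := (H.mapHomologicalComplex _).map φ
  comm₁₂ := (NatTrans.mapHomologicalComplex α _).naturality φ
  comm₂₃ := (NatTrans.mapHomologicalComplex β _).naturality φ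

/-- The connecting morphism in homology, with source and target written out. -/
noncomputable def homologyδ {K : ChainComplex C ℕ} (hK : ∀ i, Projective (K.X i)) (i : ℕ) :
    ((H.mapHomologicalComplex _).obj K).homology (i + 1) ⟶
      ((F.mapHomologicalComplex _).obj K).homology i :=
  (h.shortComplex_shortExact hK).δ (i + 1) i (by simp)

lemma homologyδ_naturality {K L : ChainComplex C ℕ} (hK : ∀ i, Projective (K.X i))
    (hL : ∀ i, Projective (L.X i)) (φ : K ⟶ L) (i : ℕ) :
    h.homologyδ hK i ≫ HomologicalComplex.homologyMap ((F.mapHomologicalComplex _).map φ) i =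
      HomologicalComplex.homologyMap ((H.mapHomologicalComplex _).map φ) (i + 1) ≫
        h.homologyδ hL i :=
  HomologicalComplex.HomologySequence.δ_naturality (h.shortComplexMap φ)
      (h.shortComplex_shortExact hK) (h.shortComplex_shortExact hL) (i + 1) i (by simp)

lemma homologyδ_comp {K : ChainComplex C ℕ} (hK : ∀ i, Projective (K.X i)) (i : ℕ) :
    h.homologyδ hK i ≫
      HomologicalComplex.homologyMap ((NatTrans.mapHomologicalComplex α _).app K) i = 0 :=
  (h.shortComplex_shortExact hK).δ_comp (i + 1) i (by simp)

lemma homologyδ_exact {K : ChainComplex C ℕ} (hK : ∀ i, Projective (K.X i)) (i : ℕ) :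
    (ShortComplex.mk _ _ (h.homologyδ_comp hK i)).Exact :=
  (h.shortComplex_shortExact hK).homology_exact₁ (i + 1) i (by simp)

lemma mono_homologyδ {K : ChainComplex C ℕ} (hK : ∀ i, Projective (K.X i)) (i : ℕ)
    (hG : IsZero (((G.mapHomologicalComplex _).obj K).homology (i + 1))) :
    Mono (h.homologyδ hK i) :=
  (h.shortComplex_shortExact hK).mono_δ (i + 1) i (by simp) hG

lemma isIso_homologyδ {K : ChainComplex C ℕ} (hK : ∀ i, Projective (K.X i)) (i : ℕ)
    (hG : IsZero (((G.mapHomologicalComplex _).obj K).homology (i + 1)))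
    (hG' : IsZero (((G.mapHomologicalComplex _).obj K).homology i)) :
    IsIso (h.homologyδ hK i) :=
  (h.shortComplex_shortExact hK).isIso_δ (i + 1) i (by simp) hG hG'

end ShortExactOnProjectives

variable [HasProjectiveResolutions C]

/-- `ProjectiveResolution.isoLeftDerivedObj` with target written as a homology object. -/
noncomputable def leftDerivedIso (F : C ⥤ D) [F.Additive] (A : C) (i : ℕ) :
    (F.leftDerived i).obj A ≅
      ((F.mapHomologicalComplex _).obj (projectiveResolution A).complex).homology i :=
  (projectiveResolution A).isoLeftDerivedObj F i

lemma leftDerivedIso_hom_naturality (F : C ⥤ D) [F.Additive] {A B : C} (f : A ⟶ B) (i : ℕ) :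
    (F.leftDerived i).map f ≫ (leftDerivedIso F B i).hom =
      (leftDerivedIso F A i).hom ≫ HomologicalComplex.homologyMap
        ((F.mapHomologicalComplex _).map (ProjectiveResolution.lift f
          (projectiveResolution A) (projectiveResolution B))) i :=
  ProjectiveResolution.isoLeftDerivedObj_hom_naturality f (projectiveResolution A)
    (projectiveResolution B) _ (ProjectiveResolution.lift_commutes_zero _ _ _) F i

lemma leftDerived_app_comp_leftDerivedIso (α : F ⟶ G) (A : C) (i : ℕ) :
    (NatTrans.leftDerived α i).app A ≫ (leftDerivedIso G A i).hom =
      (leftDerivedIso F A i).hom ≫ HomologicalComplex.homologyMap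
        ((NatTrans.mapHomologicalComplex α _).app (projectiveResolution A).complex) i := by
  rw [← Iso.eq_comp_inv, Category.assoc]
  exact (projectiveResolution A).leftDerived_app_eq α i

namespace ShortExactOnProjectives

variable {α : F ⟶ G} {β : G ⟶ H} (h : ShortExactOnProjectives α β)

/-- The connecting morphism of left derived functors. -/
noncomputable def δ (i : ℕ) : H.leftDerived (i + 1) ⟶ F.leftDerived i where
  app A := (leftDerivedIso H A (i + 1)).hom ≫
    h.homologyδ (projectiveResolution A).projective i ≫ (leftDerivedIso F A i).inv
  naturality A B f := by
    rw [← cancel_mono (leftDerivedIso F B i).hom]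
    simp only [Category.assoc, Iso.inv_hom_id, Category.comp_id]
    rw [leftDerivedIso_hom_naturality, Iso.inv_hom_id_assoc,
      reassoc_of% leftDerivedIso_hom_naturality H f (i + 1), h.homologyδ_naturality]

lemma δ_app (i : ℕ) (A : C) : (h.δ i).app A = (leftDerivedIso H A (i + 1)).hom ≫
    h.homologyδ (projectiveResolution A).projective i ≫ (leftDerivedIso F A i).inv := rfl

lemma isIso_δ (i : ℕ) (hG : ∀ A, IsZero ((G.leftDerived i).obj A))
    (hG' : ∀ A, IsZero ((G.leftDerived (i + 1)).obj A)) : IsIso (h.δ i) := by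
  rw [NatTrans.isIso_iff_isIso_app]
  intro A
  have := h.isIso_homologyδ (projectiveResolution A).projective i
    ((hG' A).of_iso (leftDerivedIso G A (i + 1)).symm)
    ((hG A).of_iso (leftDerivedIso G A i).symm)
  rw [δ_app]
  infer_instance

lemma mono_δ_app (i : ℕ) (A : C) (hG : IsZero ((G.leftDerived (i + 1)).obj A)) :
    Mono ((h.δ i).app A) := by
  have := h.mono_homologyδ (projectiveResolution A).projective i
    (hG.of_iso (leftDerivedIso G A (i + 1)).symm)
  rw [δ_app]
  infer_instance

lemma δ_comp (i : ℕ) (A : C) : (h.δ i).app A ≫ (NatTrans.leftDerived α i).app A = 0 := by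
  rw [← cancel_mono (leftDerivedIso G A i).hom, Category.assoc,
    leftDerived_app_comp_leftDerivedIso, δ_app]
  simp only [Category.assoc, Iso.inv_hom_id_assoc, h.homologyδ_comp, comp_zero, zero_comp]

lemma exact_δ (i : ℕ) (A : C) :
    (ShortComplex.mk ((h.δ i).app A) ((NatTrans.leftDerived α i).app A) (h.δ_comp i A)).Exact := by
  refine (ShortComplex.exact_iff_of_iso (ShortComplex.isoMk
    (leftDerivedIso H A (i + 1)) (leftDerivedIso F A i) (leftDerivedIso G A i) ?_ ?_)).2
    (h.homologyδ_exact (projectiveResolution A).projective i)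
  · dsimp only
    rw [δ_app, Category.assoc, Category.assoc, Iso.inv_hom_id, Category.comp_id]
  · exact (leftDerived_app_comp_leftDerivedIso α A i).symm

end ShortExactOnProjectives

/-- Naturality of `Functor.fromLeftDerivedZero` in the functor. -/
lemma leftDerived_zero_comp_fromLeftDerivedZero (α : F ⟶ G) (A : C) :
    (NatTrans.leftDerived α 0).app A ≫ G.fromLeftDerivedZero.app A =
      F.fromLeftDerivedZero.app A ≫ α.app A := by
  let P := projectiveResolution A
  have e (F : C ⥤ D) [F.Additive] : F.fromLeftDerivedZero.app A = (leftDerivedIso F A 0).hom ≫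
      HomologicalComplex.homologyι _ 0 ≫ P.fromLeftDerivedZero' F :=
    P.fromLeftDerivedZero_eq F
  have e' := HomologicalComplex.homologyι_naturality
    ((NatTrans.mapHomologicalComplex α (ComplexShape.down ℕ)).app P.complex) 0
  rw [e, e, reassoc_of% leftDerived_app_comp_leftDerivedIso α A 0, reassoc_of% e',
    Category.assoc, Category.assoc]
  congr 2
  rw [← cancel_epi (HomologicalComplex.pOpcycles _ _),
    HomologicalComplex.p_opcyclesMap_assoc, P.pOpcycles_comp_fromLeftDerivedZero',
    P.pOpcycles_comp_fromLeftDerivedZero'_assoc]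
  exact (α.naturality (P.π.f 0)).symm

lemma isZero_leftDerived_obj_succ_of_exact (i : ℕ) (A : C)
    (hF : ∀ S : ShortComplex C, S.Exact → (S.map F).Exact) :
    IsZero ((F.leftDerived (i + 1)).obj A) := by
  let P := projectiveResolution A
  refine IsZero.of_iso ?_ (P.isoLeftDerivedObj F (i + 1))
  erw [← HomologicalComplex.exactAt_iff_isZero_homology]
  exact hF _ (P.complex_exactAt_succ i)

end LeftDerivedSequence

end CategoryTheory

/-! ### Ext in the second variable and dimension shifting -/

section ExtSequence

open Limits

variable {R : Type u} [CommRing R]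

/-- The functor `Hom(-, W)` as a covariant functor to the opposite category. -/
noncomputable abbrev homInto (W : ModuleCat.{u} R) : ModuleCat.{u} R ⥤ (ModuleCat.{u} R)ᵒᵖ :=
  ((linearYoneda R (ModuleCat.{u} R)).obj W).rightOp

/-- The contravariant functor `Extⁱ(-, W)`. -/
noncomputable abbrev extInto (W : ModuleCat.{u} R) (i : ℕ) :
    (ModuleCat.{u} R)ᵒᵖ ⥤ ModuleCat.{u} R :=
  ((homInto W).leftDerived i).leftOp

/-- Contravariant functoriality of `homInto`. -/
noncomputable abbrev homIntoMap {V W : ModuleCat.{u} R} (f : V ⟶ W) : homInto W ⟶ homInto V :=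
  NatTrans.rightOp ((linearYoneda R (ModuleCat.{u} R)).map f)

/-- Colimits of functors are computed pointwise; in this form natural isomorphisms between Ext
functors pass directly to local cohomology. -/
noncomputable def localCohomologyObjIso (I : Ideal R) (i : ℕ) (X : ModuleCat.{u} R) :
    (localCohomology I i).obj X ≅
      colimit ((localCohomology.ringModIdeals (localCohomology.idealPowersDiagram I)).op ⋙
        extInto X i) :=
  colimitObjIsoColimitCompEvaluation
    (localCohomology.diagram (localCohomology.idealPowersDiagram I) i) X

lemma homInto_map_exact_of_injective (E : ModuleCat.{u} R) [Injective E]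
    (T : ShortComplex (ModuleCat.{u} R)) (hT : T.Exact) : (T.map (homInto E)).Exact := by
  rw [← ShortComplex.exact_unop_iff, ShortComplex.moduleCat_exact_iff]
  intro (x : T.X₂ ⟶ E) (hx : T.f ≫ x = 0)
  exact ⟨hT.descToInjective x hx, hT.comp_descToInjective x hx⟩

lemma isZero_leftDerived_homInto_of_injective (E A : ModuleCat.{u} R) [Injective E] (i : ℕ) :
    IsZero (((homInto E).leftDerived (i + 1)).obj A) :=
  isZero_leftDerived_obj_succ_of_exact i A (homInto_map_exact_of_injective E)

/-- Hom(P, -) is exact for projective P. The maps appear in the order `T.g`, `T.f` because `homInto`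
takes values in the opposite category. -/
lemma homInto_shortExactOnProjectives {T : ShortComplex (ModuleCat.{u} R)} (hT : T.ShortExact) :
    ShortExactOnProjectives (homIntoMap T.g) (homIntoMap T.f) where
  zero A := by
    apply Quiver.Hom.unop_inj
    ext (x : A ⟶ T.X₁)
    change (x ≫ T.f) ≫ T.g = 0
    simp
  shortExact P _ := by
    have hw : ((linearYoneda R (ModuleCat.{u} R)).map T.f).app (.op P) ≫
        ((linearYoneda R (ModuleCat.{u} R)).map T.g).app (.op P) = 0 := by
      ext (x : P ⟶ T.X₁)
      change (x ≫ T.f) ≫ T.g = 0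
      simp
    have := hT.mono_f
    refine ShortComplex.ShortExact.op (S := ShortComplex.mk
      (((linearYoneda R (ModuleCat.{u} R)).map T.f).app (.op P))
      (((linearYoneda R (ModuleCat.{u} R)).map T.g).app (.op P)) hw)
      (ModuleCat.shortComplex_shortExact _ ?_ ?_ ?_)
    · intro (x : P ⟶ T.X₂)
      refine ⟨fun (hx : x ≫ T.g = 0) => ?_, ?_⟩
      · exact ⟨hT.exact.lift x hx, hT.exact.lift_f x hx⟩
      · rintro ⟨y, rfl⟩
        exact (by simp : ∀ z : P ⟶ T.X₁, (z ≫ T.f) ≫ T.g = 0) y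
    · intro (x : P ⟶ T.X₁) (y : P ⟶ T.X₁) (h : x ≫ T.f = y ≫ T.f)
      exact (cancel_mono T.f).1 h
    · intro (y : P ⟶ T.X₃)
      have := hT.epi_g
      exact ⟨Projective.factorThru y T.g, Projective.factorThru_comp y T.g⟩

/-- This is left exactness of Hom(-, W); it makes `fromLeftDerivedZero` invertible, identifying Ext⁰
with Hom. -/
instance (W : ModuleCat.{u} R) : PreservesFiniteColimits (homInto W) := by
  refine (((homInto W).preservesFiniteColimits_tfae).out 0 3).1 fun T hT => ?_
  have := hT.epi_g
  constructor
  · rw [← ShortComplex.exact_unop_iff, ShortComplex.moduleCat_exact_iff]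
    intro (x : T.X₂ ⟶ W) (hx : T.f ≫ x = 0)
    exact ⟨hT.exact.desc x hx, hT.exact.g_desc x hx⟩
  · have : Mono (((linearYoneda R (ModuleCat.{u} R)).obj W).map T.g.op) := by
      rw [ModuleCat.mono_iff_injective]
      intro (x : T.X₃ ⟶ W) (y : T.X₃ ⟶ W) (h : T.g ≫ x = T.g ≫ y)
      exact (cancel_epi T.g).1 h
    dsimp
    infer_instance

/-- Dimension shifting for local cohomology. -/
theorem localCohomology_succ_iso (I : Ideal R) {T : ShortComplex (ModuleCat.{u} R)}
    (hT : T.ShortExact) [Injective T.X₂] (i : ℕ) :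
    Nonempty ((localCohomology I (i + 2)).obj T.X₁ ≅ (localCohomology I (i + 1)).obj T.X₃) := by
  let h := homInto_shortExactOnProjectives hT
  -- Both neighbouring groups Ext^{i+1}(-, E) and Ext^{i+2}(-, E) vanish, the degrees being
  -- positive.
  have : IsIso (h.δ (i + 1)) :=
    h.isIso_δ (i + 1) (fun A => isZero_leftDerived_homInto_of_injective _ A i)
      (fun A => isZero_leftDerived_homInto_of_injective _ A (i + 1))
  have : IsIso (NatTrans.leftOp (h.δ (i + 1))) := by
    rw [NatTrans.isIso_iff_isIso_app]
    intro A
    dsimp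
    infer_instance
  exact ⟨localCohomologyObjIso I (i + 2) T.X₁ ≪≫
    HasColimit.isoOfNatIso (Functor.isoWhiskerLeft _
      (asIso (NatTrans.leftOp (h.δ (i + 1))) : extInto T.X₃ (i + 1) ≅ extInto T.X₁ (i + 2)).symm)
    ≪≫ (localCohomologyObjIso I (i + 1) T.X₃).symm⟩

/-- The presentation of `Ext¹(-, X)` as the cokernel of `Hom(-, E) ⟶ Hom(-, Y)`, for a short exact
sequence `0 ⟶ X ⟶ E ⟶ Y ⟶ 0` with `E` injective. -/
lemma exists_hom_to_ext_one {T : ShortComplex (ModuleCat.{u} R)}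
    (hT : T.ShortExact) [Injective T.X₂] :
    ∃ κ : (linearYoneda R (ModuleCat.{u} R)).obj T.X₃ ⟶ extInto T.X₁ 1,
      ∀ A, Function.Surjective (κ.app A) ∧
        ∀ f : A.unop ⟶ T.X₃, κ.app A f = 0 ↔ ∃ e : A.unop ⟶ T.X₂, e ≫ T.g = f := by
  let h := homInto_shortExactOnProjectives hT
  -- Read in the opposite category, this is the connecting map Hom(-, Y) ≅ Ext⁰(-, Y) → Ext¹(-, X).
  let κ : (homInto T.X₁).leftDerived 1 ⟶ homInto T.X₃ := h.δ 0 ≫ Functor.fromLeftDerivedZero _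
  have hmono (A) : Mono (κ.app A) := by
    have := h.mono_δ_app 0 A (isZero_leftDerived_homInto_of_injective _ A 0)
    dsimp [κ]
    infer_instance
  have hw (A) : κ.app A ≫ (homIntoMap T.g).app A = 0 := by
    have := (reassoc_of% (h.δ_comp 0 A)) ((homInto T.X₂).fromLeftDerivedZero.app A)
    rw [leftDerived_zero_comp_fromLeftDerivedZero, zero_comp] at this
    simpa [κ] using this
  have hexact (A) : (ShortComplex.mk _ _ (hw A)).Exact := by
    refine (ShortComplex.exact_iff_of_iso
      (S₁ := ShortComplex.mk _ _ (h.δ_comp 0 A)) (S₂ := ShortComplex.mk _ _ (hw A))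
      (ShortComplex.isoMk (Iso.refl _)
      (asIso ((homInto T.X₃).fromLeftDerivedZero.app A))
      (asIso ((homInto T.X₂).fromLeftDerivedZero.app A)) ?_ ?_)).1 (h.exact_δ 0 A)
    · simp [κ]
    · exact (leftDerived_zero_comp_fromLeftDerivedZero (homIntoMap T.g) A).symm
  refine ⟨NatTrans.leftOp κ, fun A => ⟨?_, fun f => ⟨fun hf => ?_, ?_⟩⟩⟩
  · rw [← ModuleCat.epi_iff_surjective]
    have := hmono A.unop
    dsimp
    infer_instance
  · have := (hexact A.unop).unop
    rw [ShortComplex.moduleCat_exact_iff] at this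
    exact this f hf
  · rintro ⟨e, rfl⟩
    exact congrArg (fun φ => φ.unop.hom e) (hw A.unop)

end ExtSequence

/-! ### Torsion with respect to an ideal -/

section Torsion

variable {R : Type*} [CommRing R]

/-- The submodule of elements annihilated by some power of `I`. -/
def idealTorsion (I : Ideal R) (M : Type*) [AddCommGroup M] [Module R M] : Submodule R M where
  carrier := {x | ∃ k : ℕ, ∀ r ∈ I ^ k, r • x = 0}
  zero_mem' := ⟨0, fun r _ => smul_zero r⟩
  add_mem' := by
    rintro x y ⟨k, hk⟩ ⟨l, hl⟩
    refine ⟨max k l, fun r hr => ?_⟩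
    rw [smul_add, hk r (Ideal.pow_le_pow_right (le_max_left k l) hr),
      hl r (Ideal.pow_le_pow_right (le_max_right k l) hr), add_zero]
  smul_mem' := by
    rintro c x ⟨k, hk⟩
    exact ⟨k, fun r hr => by rw [smul_comm, hk r hr, smul_zero]⟩

variable {I : Ideal R} {M N : Type*} [AddCommGroup M] [Module R M] [AddCommGroup N] [Module R N]

lemma map_mem_idealTorsion (f : M →ₗ[R] N) {x : M} (hx : x ∈ idealTorsion I M) :
    f x ∈ idealTorsion I N := by
  obtain ⟨k, hk⟩ := hx
  exact ⟨k, fun r hr => by rw [← map_smul, hk r hr, map_zero]⟩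

end Torsion

/-! ### The first local cohomology as the cokernel of Γ(E) → Γ(Y) -/

section FirstLocalCohomology

open Limits Opposite

variable {R : Type u} [CommRing R] (I : Ideal R)

/-- The morphism `R ⧸ Iᵏ ⟶ Y` with value `y` at `1`, for `y` annihilated by `Iᵏ`. -/
noncomputable def homOfAnnihilated {Y : ModuleCat.{u} R} (k : ℕ) (y : Y)
    (hy : ∀ r ∈ I ^ k, r • y = 0) :
    ModuleCat.of R (R ⧸ I ^ k) ⟶ Y :=
  ModuleCat.ofHom ((I ^ k).liftQ (LinearMap.toSpanSingleton R Y y) fun r hr => hy r hr)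

lemma homOfAnnihilated_mk {Y : ModuleCat.{u} R} (k : ℕ) (y : Y) (hy : ∀ r ∈ I ^ k, r • y = 0)
    (r : R) : homOfAnnihilated I k y hy (Ideal.Quotient.mk (I ^ k) r) = r • y := rfl

variable {I}

lemma hom_ext_one {k : ℕ} {Y : ModuleCat.{u} R} {f g : ModuleCat.of R (R ⧸ I ^ k) ⟶ Y}
    (h : f (1 : R ⧸ I ^ k) = g (1 : R ⧸ I ^ k)) : f = g := by
  refine ModuleCat.hom_ext (LinearMap.ext fun x => ?_)
  obtain ⟨r, rfl⟩ := Ideal.Quotient.mk_surjective (I := I ^ k) x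
  have : Ideal.Quotient.mk (I ^ k) r = r • (1 : R ⧸ I ^ k) := by
    rw [Algebra.smul_def, mul_one]; rfl
  rw [this]
  exact ((f.hom.map_smul r 1).trans (congrArg _ h)).trans (g.hom.map_smul r 1).symm

lemma smul_hom_one_eq_zero {k : ℕ} {Y : ModuleCat.{u} R} (f : ModuleCat.of R (R ⧸ I ^ k) ⟶ Y)
    {r : R} (hr : r ∈ I ^ k) : r • f (1 : R ⧸ I ^ k) = 0 := by
  have : r • (1 : R ⧸ I ^ k) = 0 := by
    rw [Algebra.smul_def, mul_one]; exact Ideal.Quotient.eq_zero_iff_mem.2 hr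
  exact ((f.hom.map_smul r 1).symm.trans (congrArg f.hom this)).trans f.hom.map_zero

variable (I)

/-- The first local cohomology module as a cokernel of torsion submodules. -/
theorem exists_idealTorsion_to_localCohomology_one {T : ShortComplex (ModuleCat.{u} R)}
    (hT : T.ShortExact) [Injective T.X₂] :
    ∃ p : idealTorsion I T.X₃ →ₗ[R] (localCohomology I 1).obj T.X₁, Function.Surjective p ∧
      ∀ y, p y = 0 ↔ ∃ e ∈ idealTorsion I T.X₂, T.g e = y := by
  obtain ⟨κ, hκ⟩ := exists_hom_to_ext_one hT
  let Q := (localCohomology.ringModIdeals (localCohomology.idealPowersDiagram I)).op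
  let Φ := Q ⋙ extInto T.X₁ 1
  let L : ModuleCat.{u} R := colimit Φ
  have : PreservesFilteredColimitsOfSize.{0, 0} (forget (ModuleCat.{u} R)) :=
    preservesFilteredColimitsOfSize_shrink.{0, u, 0, u} _
  let ι (k : ℕ) : Φ.obj (op (op k)) ⟶ L := colimit.ι Φ (op (op k))
  let v (k : ℕ) (f : ModuleCat.of R (R ⧸ I ^ k) ⟶ T.X₃) : L := ι k (κ.app (Q.obj (op (op k))) f)
  -- The transition maps come from the projections R/I^l → R/I^k, which send 1 to 1.
  have hres (k l : ℕ) (s : (op (op k) : ℕᵒᵖᵒᵖ) ⟶ op (op l)) (f : ModuleCat.of R (R ⧸ I ^ k) ⟶ T.X₃)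
      (g : ModuleCat.of R (R ⧸ I ^ l) ⟶ T.X₃) (hfg : f (1 : R ⧸ I ^ k) = g (1 : R ⧸ I ^ l)) :
      κ.app (Q.obj (op (op l))) g = Φ.map s (κ.app (Q.obj (op (op k))) f) := by
    have e : (Q.map s).unop ≫ f = g := hom_ext_one hfg
    rw [← e]
    exact congrArg (fun φ => φ.hom f) (κ.naturality (Q.map s))
  have hv' (k l : ℕ) (h : k ≤ l) (f : ModuleCat.of R (R ⧸ I ^ k) ⟶ T.X₃)
      (g : ModuleCat.of R (R ⧸ I ^ l) ⟶ T.X₃) (hfg : f (1 : R ⧸ I ^ k) = g (1 : R ⧸ I ^ l)) :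
      v k f = v l g := by
    have s : (op (op k) : ℕᵒᵖᵒᵖ) ⟶ op (op l) := (homOfLE h).op.op
    dsimp only [v]
    rw [hres k l s f g hfg]
    exact (congrArg (fun φ => φ.hom (κ.app (Q.obj (op (op k))) f)) (colimit.w Φ s)).symm
  -- The class in the colimit depends only on the value at 1, so it is a function on Γ(Y)
  -- independent of the annihilating exponent.
  have hv (k l : ℕ) (f : ModuleCat.of R (R ⧸ I ^ k) ⟶ T.X₃)
      (g : ModuleCat.of R (R ⧸ I ^ l) ⟶ T.X₃) (hfg : f (1 : R ⧸ I ^ k) = g (1 : R ⧸ I ^ l)) :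
      v k f = v l g := by
    rcases le_total k l with h | h
    · exact hv' k l h f g hfg
    · exact (hv' l k h g f hfg.symm).symm
  have hadd (k : ℕ) (f g : ModuleCat.of R (R ⧸ I ^ k) ⟶ T.X₃) : v k (f + g) = v k f + v k g := by
    dsimp only [v]
    erw [map_add, map_add]
  have hsmul (k : ℕ) (r : R) (f : ModuleCat.of R (R ⧸ I ^ k) ⟶ T.X₃) : v k (r • f) = r • v k f := by
    dsimp only [v]
    erw [map_smul, map_smul]
  have hsurj (z : L) : ∃ k f, v k f = z := by
    obtain ⟨⟨⟨k⟩⟩, x, hx⟩ := Concrete.colimit_exists_rep Φ z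
    obtain ⟨f, rfl⟩ := (hκ (Q.obj (op (op k)))).1 x
    exact ⟨k, f, hx⟩
  have hzero (k : ℕ) (f : ModuleCat.of R (R ⧸ I ^ k) ⟶ T.X₃) :
      v k f = 0 ↔ ∃ e ∈ idealTorsion I T.X₂, T.g e = f (1 : R ⧸ I ^ k) := by
    constructor
    · intro h
      -- A class that vanishes in the colimit already vanishes at a finite stage l; there f,
      -- restricted to R/I^l, lifts to E.
      obtain ⟨⟨⟨l⟩⟩, s, hs⟩ := Concrete.colimit_rep_eq_zero R Φ _ _ h
      have hle : k ≤ l := leOfHom s.unop.unop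
      let g := (Q.map s).unop ≫ f
      rw [← hres k l s f g rfl, (hκ _).2] at hs
      obtain ⟨e, he⟩ := hs
      refine ⟨e (1 : R ⧸ I ^ l), ⟨l, fun r hr => smul_hom_one_eq_zero e hr⟩, ?_⟩
      exact congrArg (fun φ => φ.hom (1 : R ⧸ I ^ l)) he
    · rintro ⟨e, ⟨l, hl⟩, he⟩
      let e' := homOfAnnihilated I l e hl
      have h1 : e' (1 : R ⧸ I ^ l) = e := (homOfAnnihilated_mk I l e hl 1).trans (one_smul R e)
      rw [hv k l f (e' ≫ T.g) (he.symm.trans (congrArg T.g h1.symm))]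
      dsimp only [v]
      exact (congrArg (ι l) (((hκ (Q.obj (op (op l)))).2 _).2 ⟨e', rfl⟩)).trans (map_zero _)
  choose k hk using fun y : idealTorsion I T.X₃ => y.2
  let h (y : idealTorsion I T.X₃) := homOfAnnihilated I (k y) y.1 (hk y)
  have h1 (y) : h y (1 : R ⧸ I ^ k y) = y.1 :=
    (homOfAnnihilated_mk I (k y) y.1 (hk y) 1).trans (one_smul R y.1)
  have hkey (y : idealTorsion I T.X₃) (l : ℕ) (f : ModuleCat.of R (R ⧸ I ^ l) ⟶ T.X₃)
      (hf : f (1 : R ⧸ I ^ l) = y.1) : v (k y) (h y) = v l f := hv _ _ _ _ ((h1 y).trans hf.symm)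
  let p : idealTorsion I T.X₃ →ₗ[R] L :=
    { toFun y := v (k y) (h y)
      map_add' := fun y z => by
        let m := max (k y) (k z)
        let f := homOfAnnihilated I m y.1
          fun r hr => hk y r (Ideal.pow_le_pow_right (le_max_left _ _) hr)
        let g := homOfAnnihilated I m z.1
          fun r hr => hk z r (Ideal.pow_le_pow_right (le_max_right _ _) hr)
        have hf : f (1 : R ⧸ I ^ m) = y.1 := (homOfAnnihilated_mk I m _ _ 1).trans (one_smul R _)
        have hg : g (1 : R ⧸ I ^ m) = z.1 := (homOfAnnihilated_mk I m _ _ 1).trans (one_smul R _)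
        rw [hkey y m f hf, hkey z m g hg, ← hadd]
        exact hkey _ _ _ (congrArg₂ (· + ·) hf hg)
      map_smul' := fun r y => by
        rw [RingHom.id_apply, ← hsmul]
        exact hkey _ _ _ (congrArg (r • ·) (h1 y)) }
  let e : L ≅ (localCohomology I 1).obj T.X₁ := (localCohomologyObjIso I 1 T.X₁).symm
  refine ⟨e.toLinearEquiv.toLinearMap ∘ₗ p, e.toLinearEquiv.surjective.comp fun z => ?_,
    fun y => ?_⟩
  · obtain ⟨l, f, rfl⟩ := hsurj z
    exact ⟨⟨f (1 : R ⧸ I ^ l), l, fun r hr => smul_hom_one_eq_zero f hr⟩, hkey _ _ _ rfl⟩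
  · rw [LinearMap.comp_apply, LinearEquiv.coe_coe, LinearEquiv.map_eq_zero_iff]
    exact (hzero (k y) (h y)).trans (by rw [h1 y])

end FirstLocalCohomology

/-! ### Matrices acting on powers of a module -/

section MatrixAction

variable {R : Type*} [CommRing R] {l m n : Type*} [Fintype n]
  {M N : Type*} [AddCommGroup M] [Module R M] [AddCommGroup N] [Module R N]

/-- The linear map `Mⁿ → Mᵐ` given by an `m × n` matrix over `R`. -/
def Matrix.act (M : Type*) [AddCommGroup M] [Module R M] (A : Matrix m n R) :
    (n → M) →ₗ[R] (m → M) where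
  toFun f i := ∑ j, A i j • f j
  map_add' f g := by
    ext i
    simp [Finset.sum_add_distrib]
  map_smul' r f := by
    ext i
    simp [Finset.smul_sum, smul_comm r]

lemma Matrix.act_apply (A : Matrix m n R) (f : n → M) (i : m) :
    A.act M f i = ∑ j, A i j • f j := rfl

lemma Matrix.act_act [Fintype m] (A : Matrix l m R) (B : Matrix m n R) (f : n → M) :
    A.act M (B.act M f) = (A * B).act M f := by
  ext i
  simp only [Matrix.act_apply, Matrix.mul_apply, Finset.smul_sum, Finset.sum_smul, smul_smul]
  rw [Finset.sum_comm]

lemma Matrix.act_zero (f : n → M) : (0 : Matrix m n R).act M f = 0 := by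
  ext i
  simp [Matrix.act_apply]

lemma Matrix.act_add (A B : Matrix m n R) (f : n → M) :
    (A + B).act M f = A.act M f + B.act M f := by
  ext i
  simp [Matrix.act_apply, add_smul, Finset.sum_add_distrib]

lemma Matrix.act_smul_one [DecidableEq n] (r : R) (f : n → M) :
    (r • (1 : Matrix n n R)).act M f = r • f := by
  ext i
  simp [Matrix.act_apply, Matrix.one_apply]

lemma Matrix.act_map (A : Matrix m n R) (φ : M →ₗ[R] N) (f : n → M) :
    A.act N (fun j => φ (f j)) = fun i => φ (A.act M f i) := by
  ext i
  simp [Matrix.act_apply]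

end MatrixAction

/-- A bounded complex of finite free modules (given by matrices) starting in degree zero with the
ring, on which each of the elements of `l` is null-homotopic. -/
structure KoszulData {R : Type*} [CommRing R] (l : List R) where
  ι : ℕ → Type
  fintype : ∀ k, Fintype (ι k)
  decEq : ∀ k, DecidableEq (ι k)
  A : ∀ k, Matrix (ι k) (ι (k + 1)) R
  mul_eq_zero : ∀ k, A k * A (k + 1) = 0
  isEmpty : ∀ k, l.length < k → IsEmpty (ι k)
  unique : Unique (ι 0)
  mem_span : ∀ i j, A 0 i j ∈ Ideal.span {x | x ∈ l}
  homotopy : ∀ x ∈ l, ∃ h : ∀ k, Matrix (ι (k + 1)) (ι k) R, A 0 * h 0 = x • 1 ∧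
    ∀ k, A (k + 1) * h (k + 1) + h k * A k = x • 1

/-! ### Koszul complexes as iterated cones -/

namespace KoszulData

attribute [instance] fintype decEq

variable {R : Type*} [CommRing R]

/-- Index types of the complex `R` concentrated in degree zero. -/
def nilι : ℕ → Type
  | 0 => Unit
  | _ + 1 => Empty

instance : ∀ k, Fintype (nilι k)
  | 0 => inferInstanceAs (Fintype Unit)
  | _ + 1 => inferInstanceAs (Fintype Empty)

instance : ∀ k, DecidableEq (nilι k)
  | 0 => inferInstanceAs (DecidableEq Unit)
  | _ + 1 => inferInstanceAs (DecidableEq Empty)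

/-- The complex `R` concentrated in degree zero. -/
def nil : KoszulData ([] : List R) where
  ι := nilι
  fintype := inferInstance
  decEq := inferInstance
  A k := 0
  mul_eq_zero k := Matrix.zero_mul _
  isEmpty
    | 0, hk => by simp at hk
    | k + 1, _ => inferInstanceAs (IsEmpty Empty)
  unique := inferInstanceAs (Unique Unit)
  mem_span i j := by simp
  homotopy x hx := by simp at hx

/-- Index types of the cone construction. -/
def consι (ι : ℕ → Type) : ℕ → Type
  | 0 => ι 0
  | k + 1 => ι (k + 1) ⊕ ι k

instance {ι : ℕ → Type} [∀ k, Fintype (ι k)] : ∀ k, Fintype (consι ι k)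
  | 0 => inferInstanceAs (Fintype (ι 0))
  | k + 1 => inferInstanceAs (Fintype (ι (k + 1) ⊕ ι k))

instance {ι : ℕ → Type} [∀ k, DecidableEq (ι k)] : ∀ k, DecidableEq (consι ι k)
  | 0 => inferInstanceAs (DecidableEq (ι 0))
  | k + 1 => inferInstanceAs (DecidableEq (ι (k + 1) ⊕ ι k))

/-- The differential of the cone of multiplication by `x`. -/
def consA {ι : ℕ → Type} [∀ k, DecidableEq (ι k)] (A : ∀ k, Matrix (ι k) (ι (k + 1)) R) (x : R) :
    ∀ k, Matrix (consι ι k) (consι ι (k + 1)) R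
  | 0 => Matrix.fromCols (A 0) (x • (1 : Matrix (ι 0) (ι 0) R))
  | k + 1 => Matrix.fromBlocks (A (k + 1)) (x • (1 : Matrix (ι (k + 1)) (ι (k + 1)) R)) 0 (-A k)

section Blocks

set_option linter.unusedSectionVars false

open Matrix

variable {a b c d : Type*} [Fintype a] [Fintype b] [Fintype c] [DecidableEq a] [DecidableEq b]
  [DecidableEq c] (x y : R)

/-- The sign in the block `-A` makes the two terms x • A cancel. -/
lemma cone_mul_zero (A : Matrix a b R) (B : Matrix b c R) (h : A * B = 0) :
    fromCols A (x • (1 : Matrix a a R)) * fromBlocks B (x • (1 : Matrix b b R)) 0 (-A) = 0 := by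
  rw [fromCols_mul_fromBlocks]
  simp [h]

lemma cone_mul_succ (A : Matrix a b R) (B : Matrix b c R) (C : Matrix c d R)
    (h : A * B = 0) (h' : B * C = 0) :
    fromBlocks B (x • (1 : Matrix b b R)) 0 (-A) *
      fromBlocks C (x • (1 : Matrix c c R)) 0 (-B) = 0 := by
  rw [fromBlocks_multiply]
  simp [h, h']

/-- On the cone of multiplication by x, the identity from one copy of the complex to the other is a
contraction of x. -/
lemma cone_homotopy_self_zero (A : Matrix a b R) :
    fromCols A (x • (1 : Matrix a a R)) *
      fromRows (0 : Matrix b a R) (1 : Matrix a a R) = x • 1 := by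
  rw [fromCols_mul_fromRows]
  simp

lemma cone_homotopy_self_one (A : Matrix a b R) (B : Matrix b c R) :
    fromBlocks B (x • (1 : Matrix b b R)) 0 (-A) *
        fromBlocks (0 : Matrix c b R) (0 : Matrix c a R) (1 : Matrix b b R) (0 : Matrix b a R) +
      fromRows (0 : Matrix b a R) (1 : Matrix a a R) * fromCols A (x • (1 : Matrix a a R)) =
      x • (1 : Matrix (b ⊕ a) (b ⊕ a) R) := by
  rw [fromBlocks_multiply, fromRows_mul_fromCols, fromBlocks_add, ← fromBlocks_one,
    fromBlocks_smul]
  simp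

lemma cone_homotopy_self_succ (A : Matrix a b R) (B : Matrix b c R) (C : Matrix c d R)
    [Fintype d] :
    fromBlocks C (x • (1 : Matrix c c R)) 0 (-B) *
        fromBlocks (0 : Matrix d c R) (0 : Matrix d b R) (1 : Matrix c c R) (0 : Matrix c b R) +
      fromBlocks (0 : Matrix c b R) (0 : Matrix c a R) (1 : Matrix b b R)
        (0 : Matrix b a R) *
        fromBlocks B (x • (1 : Matrix b b R)) 0 (-A) =
      x • (1 : Matrix (c ⊕ b) (c ⊕ b) R) := by
  rw [fromBlocks_multiply, fromBlocks_multiply, fromBlocks_add, ← fromBlocks_one,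
    fromBlocks_smul]
  simp

/-- A homotopy g for y on the original complex extends to the cone as diag(g, -g), with zero block
in place of -g in lowest degree; the sign cancels the off-diagonal terms x • g. -/
lemma cone_homotopy_zero (A : Matrix a b R) (g : Matrix b a R) (h : A * g = y • 1) :
    fromCols A (x • (1 : Matrix a a R)) * fromRows g (0 : Matrix a a R) = y • 1 := by
  rw [fromCols_mul_fromRows]
  simp [h]

lemma cone_homotopy_one (A : Matrix a b R) (B : Matrix b c R) (g : Matrix b a R)
    (g' : Matrix c b R) (h : A * g = y • 1) (h' : B * g' + g * A = y • 1) :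
    fromBlocks B (x • (1 : Matrix b b R)) 0 (-A) * fromBlocks g' 0 0 (-g) +
      fromRows g (0 : Matrix a a R) * fromCols A (x • (1 : Matrix a a R)) =
      y • (1 : Matrix (b ⊕ a) (b ⊕ a) R) := by
  rw [fromBlocks_multiply, fromRows_mul_fromCols, fromBlocks_add, ← fromBlocks_one,
    fromBlocks_smul]
  simp [h, h']

lemma cone_homotopy_succ [Fintype d] (A : Matrix a b R) (B : Matrix b c R) (C : Matrix c d R)
    (g : Matrix b a R) (g' : Matrix c b R) (g'' : Matrix d c R) (h : B * g' + g * A = y • 1)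
    (h' : C * g'' + g' * B = y • 1) :
    fromBlocks C (x • (1 : Matrix c c R)) 0 (-B) * fromBlocks g'' 0 0 (-g') +
      fromBlocks g' 0 0 (-g) * fromBlocks B (x • (1 : Matrix b b R)) 0 (-A) =
      y • (1 : Matrix (c ⊕ b) (c ⊕ b) R) := by
  rw [fromBlocks_multiply, fromBlocks_multiply, fromBlocks_add, ← fromBlocks_one,
    fromBlocks_smul]
  simp [h, h']

end Blocks

/-- The cone of multiplication by `x`. -/
def cons {l : List R} (K : KoszulData l) (x : R) : KoszulData (x :: l) where
  ι := consι K.ι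
  fintype := inferInstance
  decEq := inferInstance
  A := consA K.A x
  mul_eq_zero
    | 0 => cone_mul_zero x _ _ (K.mul_eq_zero 0)
    | k + 1 => cone_mul_succ x _ _ _ (K.mul_eq_zero k) (K.mul_eq_zero (k + 1))
  isEmpty
    | 0, hk => by simp at hk
    | k + 1, hk => by
      have h1 := K.isEmpty (k + 1) (by simp at hk; omega)
      have h2 := K.isEmpty k (by simpa using hk)
      exact inferInstanceAs (IsEmpty (K.ι (k + 1) ⊕ K.ι k))
  unique := K.unique
  mem_span
    | i, Sum.inl j => Ideal.span_mono (s := {y | y ∈ l}) (t := {y | y ∈ x :: l})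
        (fun _ hy => List.mem_cons_of_mem _ hy) (K.mem_span i j)
    | i, Sum.inr j => Ideal.mul_mem_right ((1 : Matrix (K.ι 0) (K.ι 0) R) i j) _
        (Ideal.subset_span (s := {y | y ∈ x :: l}) List.mem_cons_self)
  homotopy y hy := by
    rcases List.mem_cons.1 hy with rfl | hy
    · let h : ∀ k, Matrix (consι K.ι (k + 1)) (consι K.ι k) R
        | 0 => Matrix.fromRows (0 : Matrix (K.ι 1) (K.ι 0) R) (1 : Matrix (K.ι 0) (K.ι 0) R)
        | k + 1 => Matrix.fromBlocks (0 : Matrix (K.ι (k + 2)) (K.ι (k + 1)) R) 0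
          (1 : Matrix (K.ι (k + 1)) (K.ι (k + 1)) R) 0
      refine ⟨h, cone_homotopy_self_zero y _, ?_⟩
      rintro (_ | k)
      · exact cone_homotopy_self_one y _ _
      · exact cone_homotopy_self_succ y _ _ _
    · obtain ⟨g, hg0, hg⟩ := K.homotopy y hy
      let h : ∀ k, Matrix (consι K.ι (k + 1)) (consι K.ι k) R
        | 0 => Matrix.fromRows (g 0) 0
        | k + 1 => Matrix.fromBlocks (g (k + 1)) 0 0 (-g k)
      refine ⟨h, cone_homotopy_zero x y _ _ hg0, ?_⟩
      rintro (_ | k)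
      · exact cone_homotopy_one x y _ _ _ _ hg0 (hg 0)
      · exact cone_homotopy_succ x y _ _ _ _ _ _ (hg k) (hg (k + 1))

/-- The Koszul complex of a list. -/
def ofList : ∀ l : List R, KoszulData l
  | [] => nil
  | x :: l => (ofList l).cons x

end KoszulData

/-! ### Closure properties of Serre classes of modules -/

section SerreClass

variable {R : Type u} [CommRing R] {S : ObjectProperty (ModuleCat.{u} R)} [S.IsSerreClass]
  {M N P : Type u} [AddCommGroup M] [Module R M] [AddCommGroup N] [Module R N]
  [AddCommGroup P] [Module R P]

lemma serre_of_injective (f : M →ₗ[R] N) (hf : Function.Injective f) (h : S (ModuleCat.of R N)) :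
    S (ModuleCat.of R M) :=
  have : Mono (ModuleCat.ofHom f) := (ModuleCat.mono_iff_injective _).2 hf
  S.prop_of_mono (ModuleCat.ofHom f) h

lemma serre_of_surjective (f : M →ₗ[R] N) (hf : Function.Surjective f)
    (h : S (ModuleCat.of R M)) : S (ModuleCat.of R N) :=
  have : Epi (ModuleCat.ofHom f) := (ModuleCat.epi_iff_surjective _).2 hf
  S.prop_of_epi (ModuleCat.ofHom f) h

lemma serre_of_exact (f : M →ₗ[R] N) (g : N →ₗ[R] P) (h : Function.Exact f g)
    (hM : S (ModuleCat.of R M)) (hP : S (ModuleCat.of R P)) : S (ModuleCat.of R N) := by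
  refine S.prop_X₂_of_exact (S := ShortComplex.mk (ModuleCat.ofHom f) (ModuleCat.ofHom g) ?_)
    (ModuleCat.shortComplex_exact _ h) hM hP
  ext x
  exact h.apply_apply_eq_zero x

/-- A Serre class contains the finite powers of its members. -/
lemma serre_pi (m : ℕ) (h : S (ModuleCat.of R M)) : S (ModuleCat.of R (Fin m → M)) := by
  induction m with
  | zero => exact S.prop_of_isZero (ModuleCat.isZero_of_subsingleton _)
  | succ m ih =>
    refine serre_of_exact (LinearMap.single R (fun _ : Fin (m + 1) => M) 0)
      (LinearMap.funLeft R M Fin.succ) (fun x => ⟨fun hx => ⟨x 0, ?_⟩, ?_⟩) h ih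
    · ext i
      refine Fin.cases ?_ (fun i => ?_) i
      · simp
      · simpa using (congrFun hx i).symm
    · rintro ⟨y, rfl⟩
      ext i
      simp [LinearMap.funLeft_apply]

lemma serre_pi_fintype (ι : Type) [Fintype ι] (h : S (ModuleCat.of R M)) :
    S (ModuleCat.of R (ι → M)) :=
  serre_of_surjective (LinearEquiv.funCongrLeft R M (Fintype.equivFin ι)).toLinearMap
    (LinearEquiv.surjective _) (serre_pi (Fintype.card ι) h)

/-- Since ψ kills boundaries it induces a map on homology, and Q is contained in the image of that
map. -/
lemma serre_of_homology (T : ShortComplex (ModuleCat.{u} R)) (ψ : T.X₂ →ₗ[R] N)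
    (hψ : ∀ x, ψ (T.f x) = 0) (Q : Submodule R N) (hQ : ∀ q ∈ Q, ∃ x, T.g x = 0 ∧ ψ x = q)
    (h : S T.homology) : S (ModuleCat.of R Q) := by
  have h' : S (ModuleCat.of R (LinearMap.ker T.g.hom ⧸ LinearMap.range T.moduleCatToCycles)) :=
    (S.prop_iff_of_iso T.moduleCatHomologyIso).1 h
  let φ := Submodule.liftQ (LinearMap.range T.moduleCatToCycles)
    (ψ ∘ₗ (LinearMap.ker T.g.hom).subtype) (by rintro _ ⟨x, rfl⟩; exact hψ x)
  have hle : Q ≤ LinearMap.range φ := by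
    intro q hq
    obtain ⟨x, hx, rfl⟩ := hQ q hq
    exact ⟨Submodule.Quotient.mk ⟨x, hx⟩, rfl⟩
  exact serre_of_injective (Submodule.inclusion hle) (Submodule.inclusion_injective _)
    (serre_of_surjective φ.rangeRestrict φ.surjective_rangeRestrict h')

/-- The cycles killed by ψ are boundaries, so the homology is a quotient of ψ(cycles), which lies in
Q. -/
lemma serre_homology (T : ShortComplex (ModuleCat.{u} R)) (ψ : T.X₂ →ₗ[R] N)
    (Q : Submodule R N) (hQ : ∀ x, T.g x = 0 → ψ x ∈ Q)
    (hψ : ∀ x, T.g x = 0 → ψ x = 0 → ∃ y, T.f y = x)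
    (h : S (ModuleCat.of R Q)) : S T.homology := by
  refine (S.prop_iff_of_iso T.moduleCatHomologyIso).2 ?_
  let φ := ψ ∘ₗ (LinearMap.ker T.g.hom).subtype
  have hle : LinearMap.range φ ≤ Q := by
    rintro _ ⟨x, rfl⟩
    exact hQ x.1 x.2
  have h' : S (ModuleCat.of R (LinearMap.range φ)) :=
    serre_of_injective (Submodule.inclusion hle) (Submodule.inclusion_injective _) h
  have h'' := serre_of_surjective φ.quotKerEquivRange.symm.toLinearMap
    φ.quotKerEquivRange.symm.surjective h'
  refine serre_of_surjective ((LinearMap.ker φ).liftQ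
    (Submodule.mkQ (LinearMap.range T.moduleCatToCycles)) ?_) (fun y => ?_) h''
  · intro x hx
    rw [LinearMap.mem_ker, Submodule.mkQ_apply, Submodule.Quotient.mk_eq_zero]
    obtain ⟨y, hy⟩ := hψ x.1 x.2 hx
    exact ⟨y, Subtype.ext hy⟩
  · obtain ⟨x, rfl⟩ := Submodule.mkQ_surjective _ y
    exact ⟨Submodule.Quotient.mk x, rfl⟩

end SerreClass

/-! ### Koszul complexes with coefficients and their long exact sequence -/

namespace KoszulData

variable {R : Type u} [CommRing R] {l : List R} (K : KoszulData l)

/-- The complex `K ⊗ M`. -/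
noncomputable def complex (M : Type u) [AddCommGroup M] [Module R M] :
    ChainComplex (ModuleCat.{u} R) ℕ :=
  ChainComplex.of (fun k => ModuleCat.of R (K.ι k → M))
    (fun k => ModuleCat.ofHom ((K.A k).act M)) fun k => by
      refine ModuleCat.hom_ext (LinearMap.ext fun f => ?_)
      refine ((K.A k).act_act (M := M) (K.A (k + 1)) f).trans ?_
      rw [K.mul_eq_zero, Matrix.act_zero]
      rfl

variable {M N P : Type u} [AddCommGroup M] [Module R M] [AddCommGroup N] [Module R N]
  [AddCommGroup P] [Module R P]

lemma complex_d (k : ℕ) : (K.complex M).d (k + 1) k = ModuleCat.ofHom ((K.A k).act M) :=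
  ChainComplex.of_d (fun k => ModuleCat.of R (K.ι k → M))
    (fun k => ModuleCat.ofHom ((K.A k).act M)) k

lemma complex_d_apply (k : ℕ) (z : K.ι (k + 1) → M) :
    (K.complex M).d (k + 1) k z = (K.A k).act M z :=
  congrArg (fun φ => φ.hom z) (K.complex_d k)

/-- Functoriality of `complex`. -/
noncomputable def complexMap (φ : M →ₗ[R] N) : K.complex M ⟶ K.complex N :=
  ChainComplex.ofHom (fun k => ModuleCat.ofHom (φ.compLeft (K.ι k))) fun k => by
    rw [complex_d, complex_d]
    refine ModuleCat.hom_ext (LinearMap.ext fun f => ?_)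
    exact (K.A k).act_map φ f

/-- The short complex of complexes associated with `M → N → P`. -/
noncomputable def shortComplex (f : M →ₗ[R] N) (g : N →ₗ[R] P) (h : Function.Exact f g) :
    ShortComplex (ChainComplex (ModuleCat.{u} R) ℕ) :=
  ShortComplex.mk (K.complexMap f) (K.complexMap g) (by
    ext k x
    funext i
    exact h.apply_apply_eq_zero (x i))

variable {f : M →ₗ[R] N} {g : N →ₗ[R] P} (hf : Function.Injective f) (h : Function.Exact f g)
  (hg : Function.Surjective g)

include hf hg in
lemma shortComplex_shortExact : (K.shortComplex f g h).ShortExact := by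
  refine HomologicalComplex.shortExact_of_degreewise_shortExact _ fun k => ?_
  refine ModuleCat.shortComplex_shortExact _ (fun x => ⟨fun hx => ?_, ?_⟩) ?_ ?_
  · choose y hy using fun i => (h (x i)).1 (congrFun hx i)
    exact ⟨y, funext hy⟩
  · rintro ⟨y, rfl⟩
    exact funext fun i => h.apply_apply_eq_zero (y i)
  · exact fun x y hxy => funext fun i => hf (congrFun hxy i)
  · intro y
    choose x hx using fun i => hg (y i)
    exact ⟨x, funext hx⟩

variable {S : ObjectProperty (ModuleCat.{u} R)} [S.IsSerreClass] {k : ℕ}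

include hf h hg

lemma serre_homology_left (h₁ : S ((K.complex P).homology (k + 1)))
    (h₂ : S ((K.complex N).homology k)) : S ((K.complex M).homology k) :=
  S.prop_X₂_of_exact ((K.shortComplex_shortExact hf h hg).homology_exact₁ (k + 1) k (by simp))
    h₁ h₂

lemma serre_homology_right (h₁ : S ((K.complex N).homology (k + 1)))
    (h₂ : S ((K.complex M).homology k)) : S ((K.complex P).homology (k + 1)) :=
  S.prop_X₂_of_exact ((K.shortComplex_shortExact hf h hg).homology_exact₃ (k + 1) k (by simp))
    h₁ h₂

end KoszulData

/-! ### Linear systems over injective modules -/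

section InjectiveModules

variable {R : Type u} [CommRing R] {D : Type u} [AddCommGroup D] [Module R D]

/-- Extension of linear maps to an injective module along a map with smaller kernel. -/
lemma Module.Injective.exists_extension [Module.Injective R D] {A B : Type u} [AddCommGroup A]
    [Module R A] [AddCommGroup B] [Module R B] (φ : A →ₗ[R] B) (f : A →ₗ[R] D)
    (h : LinearMap.ker φ ≤ LinearMap.ker f) : ∃ g : B →ₗ[R] D, ∀ a, g (φ a) = f a := by
  obtain ⟨g, hg⟩ := Module.Injective.out ((LinearMap.ker φ).liftQ φ le_rfl)
    (LinearMap.ker_eq_bot.1 (Submodule.ker_liftQ_eq_bot' _ _ rfl)) ((LinearMap.ker φ).liftQ f h)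
  exact ⟨g, fun a => hg (Submodule.Quotient.mk a)⟩

lemma Matrix.sum_smul_act {M : Type*} [AddCommGroup M] [Module R M] {m n : Type*} [Fintype m]
    [Fintype n] (A : Matrix m n R) (r : m → R) (hr : ∀ j, ∑ i, r i * A i j = 0) (w : n → M) :
    ∑ i, r i • A.act M w i = 0 := by
  simp_rw [Matrix.act_apply, Finset.smul_sum, smul_smul]
  rw [Finset.sum_comm]
  simp_rw [← Finset.sum_smul, hr, zero_smul, Finset.sum_const_zero]

/-- Solvability of linear systems over an injective module. -/
lemma Module.Injective.exists_act_eq [Module.Injective R D] {m n : Type} [Fintype m] [Fintype n]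
    [DecidableEq n] (A : Matrix m n R) (v : m → D)
    (h : ∀ r : m → R, (∀ j, ∑ i, r i * A i j = 0) → ∑ i, r i • v i = 0) :
    ∃ w, A.act D w = v := by
  classical
  -- The hypothesis says that r ↦ Σ rᵢvᵢ kills the kernel of r ↦ rA, so it extends along the latter;
  -- the values of the extension on the standard basis solve the system.
  obtain ⟨g, hg⟩ := Module.Injective.exists_extension (D := D) (Matrix.vecMulLinear A)
    (Fintype.linearCombination R v) fun r hr => h r fun j => congrFun hr j
  refine ⟨fun j => g (Pi.single j 1), funext fun i => ?_⟩
  have e := hg (Pi.single i 1)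
  rw [Fintype.linearCombination_apply_single, one_smul] at e
  rw [← e, Matrix.vecMulLinear_apply, Matrix.single_one_vecMul, Matrix.act_apply]
  conv_rhs => rw [pi_eq_sum_univ' (A.row i), map_sum]
  refine Finset.sum_congr rfl fun j _ => ?_
  rw [map_smul]
  rfl

end InjectiveModules

/-! ### Torsion in injective modules over a Noetherian ring -/

section IdealTorsion

variable {R : Type u} [CommRing R] (I : Ideal R)

lemma exists_pow_smul_eq_zero_of_fg {M : Type*} [AddCommGroup M] [Module R M]
    {P : Submodule R M} (hP : P.FG) (h : P ≤ idealTorsion I M) :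
    ∃ k, ∀ r ∈ I ^ k, ∀ x ∈ P, r • x = 0 := by
  obtain ⟨s, rfl⟩ := hP
  choose k hk using fun x : s => h (Submodule.subset_span x.2)
  refine ⟨Finset.univ.sup k, fun r hr x hx => ?_⟩
  have : Submodule.span R (s : Set M) ≤ LinearMap.ker (LinearMap.lsmul R M r) :=
    Submodule.span_le.2 fun y hy => hk ⟨y, hy⟩ r
      (Ideal.pow_le_pow_right (Finset.le_sup (Finset.mem_univ _)) hr)
  exact this hx

variable [IsNoetherianRing R]

/-- As I^t is finitely generated, a single power I^k kills I^t x, and then I^{k+t} kills x. -/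
lemma mem_idealTorsion_of_smul_mem {M : Type*} [AddCommGroup M] [Module R M] {x : M} {t : ℕ}
    (h : ∀ r ∈ I ^ t, r • x ∈ idealTorsion I M) : x ∈ idealTorsion I M := by
  obtain ⟨k, hk⟩ := exists_pow_smul_eq_zero_of_fg I
    (P := Submodule.map (LinearMap.toSpanSingleton R M x) (I ^ t : Ideal R))
    (Submodule.FG.map _ (IsNoetherian.noetherian (I ^ t : Ideal R)))
    (by rintro _ ⟨r, hr, rfl⟩; exact h r hr)
  refine ⟨k + t, fun r hr => ?_⟩
  rw [pow_add] at hr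
  refine Submodule.mul_induction_on hr (fun a ha b hb => ?_) fun a b ha hb => ?_
  · rw [mul_smul]
    exact hk a ha _ ⟨b, hb, rfl⟩
  · rw [add_smul, ha, hb, add_zero]

variable {E : Type u} [AddCommGroup E] [Module R E] [Module.Injective R E]

/-- Over a Noetherian ring the torsion submodule of an injective module is injective. -/
instance idealTorsion_injective : Module.Injective R (idealTorsion I E) := by
  refine Module.Baer.injective fun J f => ?_
  let f' : J →ₗ[R] E := (idealTorsion I E).subtype ∘ₗ f
  obtain ⟨t, ht⟩ := exists_pow_smul_eq_zero_of_fg I (P := LinearMap.range f')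
    (by rw [LinearMap.range_eq_map]; exact (IsNoetherian.noetherian _).map f')
    (by rintro _ ⟨x, rfl⟩; exact (f x).2)
  obtain ⟨k, hk⟩ := Ideal.exists_pow_inf_eq_pow_smul I (J : Submodule R R)
  -- By Artin–Rees, I^{k+t} ∩ J ⊆ I^t J, on which f' vanishes. Hence f' factors through the image of
  -- J in R/I^{k+t}, and any extension to R/I^{k+t} has torsion values.
  have hker : LinearMap.ker ((I ^ (k + t)).mkQ ∘ₗ J.subtype) ≤ LinearMap.ker f' := by
    intro x hx
    have hx' : x.1 ∈ I ^ (k + t) := (Submodule.Quotient.mk_eq_zero (I ^ (k + t))).1 hx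
    have hmem : x.1 ∈ (I ^ t • (J : Submodule R R)) := by
      have h1 : x.1 ∈ I ^ (k + t) • (⊤ : Submodule R R) ⊓ J := ⟨by simpa using hx', x.2⟩
      rw [hk (k + t) (Nat.le_add_right _ _), Nat.add_sub_cancel_left] at h1
      exact Submodule.smul_mono le_rfl inf_le_right h1
    have key : ∀ y ∈ I ^ t • (J : Submodule R R), ∃ hy : y ∈ J, f' ⟨y, hy⟩ = 0 := by
      intro y hy
      refine Submodule.smul_induction_on hy (fun r hr z hz => ?_) ?_
      · exact ⟨J.smul_mem r hz, (f'.map_smul r ⟨z, hz⟩).trans (ht r hr _ ⟨_, rfl⟩)⟩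
      · rintro a b ⟨ha, ha'⟩ ⟨hb, hb'⟩
        exact ⟨J.add_mem ha hb, (f'.map_add ⟨a, ha⟩ ⟨b, hb⟩).trans (by rw [ha', hb', add_zero])⟩
    exact (key x.1 hmem).2
  obtain ⟨g, hg⟩ := Module.Injective.exists_extension (D := E) _ f' hker
  refine ⟨(g ∘ₗ (I ^ (k + t)).mkQ).codRestrict _ fun r => ⟨k + t, fun s hs => ?_⟩, fun x hx => ?_⟩
  · have e : (I ^ (k + t)).mkQ (s • r) = 0 :=
      (Submodule.Quotient.mk_eq_zero (I ^ (k + t))).2 (Ideal.mul_mem_right r _ hs)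
    rw [← map_smul, LinearMap.comp_apply, e, map_zero]
  · exact Subtype.ext (hg ⟨x, hx⟩)

/-- The injective submodule Γ(E) is a direct summand, so E/Γ(E) is a retract of E; the section comes
from id - ρ, with ρ a retraction onto Γ(E). -/
instance quotient_idealTorsion_injective : Module.Injective R (E ⧸ idealTorsion I E) := by
  obtain ⟨ρ, hρ⟩ := Module.Injective.out (idealTorsion I E).subtype Subtype.val_injective
    (LinearMap.id (R := R) (M := idealTorsion I E))
  let s : (E ⧸ idealTorsion I E) →ₗ[R] E :=
    (idealTorsion I E).liftQ (LinearMap.id - (idealTorsion I E).subtype ∘ₗ ρ) fun x hx => by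
      simpa [sub_eq_zero] using (congrArg Subtype.val (hρ ⟨x, hx⟩)).symm
  have hs (y) : (idealTorsion I E).mkQ (s y) = y := by
    obtain ⟨x, rfl⟩ := Submodule.mkQ_surjective _ y
    simp [s]
  refine ⟨fun A B _ _ _ _ φ hφ f => ?_⟩
  obtain ⟨g, hg⟩ := Module.Injective.out φ hφ (s ∘ₗ f)
  exact ⟨(idealTorsion I E).mkQ ∘ₗ g, fun x => by simp [hg, hs]⟩

lemma quotient_idealTorsion_torsionFree {M : Type*} [AddCommGroup M] [Module R M] (t : ℕ)
    (y : M ⧸ idealTorsion I M) (h : ∀ r ∈ I ^ t, r • y = 0) : y = 0 := by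
  obtain ⟨x, rfl⟩ := Submodule.mkQ_surjective _ y
  rw [Submodule.mkQ_apply, Submodule.Quotient.mk_eq_zero]
  refine mem_idealTorsion_of_smul_mem I (t := t) fun r hr => ?_
  rw [← Submodule.Quotient.mk_eq_zero]
  exact h r hr

end IdealTorsion

/-! ### Koszul homology in a Serre class, and its vanishing for torsion-free injectives -/

namespace KoszulData

variable {R : Type u} [CommRing R] {l : List R} (K : KoszulData l)
  {S : ObjectProperty (ModuleCat.{u} R)} [S.IsSerreClass]
  {M : Type u} [AddCommGroup M] [Module R M]

lemma serre_homology_of_length_lt {k : ℕ} (hk : l.length < k) : S ((K.complex M).homology k) := by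
  have := K.isEmpty k hk
  refine S.prop_of_isZero ?_
  rw [← HomologicalComplex.exactAt_iff_isZero_homology]
  exact ShortComplex.exact_of_isZero_X₂ _
    (ModuleCat.isZero_of_subsingleton (ModuleCat.of R (K.ι k → M)))

lemma serre_homology_of_serre (h : S (ModuleCat.of R M)) (k : ℕ) :
    S ((K.complex M).homology k) :=
  _root_.serre_homology ((K.complex M).sc k) (LinearMap.id (R := R) (M := K.ι k → M)) ⊤
    (fun _ _ => trivial) (fun x _ hx => ⟨0, by rw [map_zero]; exact hx.symm⟩)
    (serre_of_injective (Submodule.subtype _) Subtype.val_injective (serre_pi_fintype (K.ι k) h))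

lemma serre_of_homology_one {N : Type u} [AddCommGroup N] [Module R N]
    (ψ : (K.ι 1 → M) →ₗ[R] N) (hψ : ∀ w, ψ ((K.A 1).act M w) = 0) (Q : Submodule R N)
    (hQ : ∀ q ∈ Q, ∃ z, (K.A 0).act M z = 0 ∧ ψ z = q) (h : S ((K.complex M).homology 1)) :
    S (ModuleCat.of R Q) := by
  refine serre_of_homology ((K.complex M).sc' 2 1 0) ψ (fun x => ?_) Q (fun q hq => ?_)
    ((S.prop_iff_of_iso ((K.complex M).homologyIsoSc' 2 1 0 (by simp) (by simp))).1 h)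
  · exact (congrArg ψ (K.complex_d_apply 1 x)).trans (hψ x)
  · obtain ⟨z, hz, hz'⟩ := hQ q hq
    exact ⟨z, (K.complex_d_apply 0 z).trans hz, hz'⟩

lemma serre_quotient_of_homology_zero (h : S ((K.complex M).homology 0)) :
    S (ModuleCat.of R (M ⧸ (Ideal.span {x | x ∈ l} • ⊤ : Submodule R M))) := by
  have := K.unique
  let ψ : (K.ι 0 → M) →ₗ[R] (M ⧸ (Ideal.span {x | x ∈ l} • ⊤ : Submodule R M)) :=
    Submodule.mkQ _ ∘ₗ LinearMap.proj default
  -- Degree 0 has no successor in the complex shape, so it is its own default successor, with zero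
  -- differential; every element is a cycle.
  have := serre_of_homology ((K.complex M).sc' 1 0 0) ψ (fun x => ?_) ⊤ (fun q _ => ?_)
    ((S.prop_iff_of_iso ((K.complex M).homologyIsoSc' 1 0 0 (by simp) (by simp))).1 h)
  · exact serre_of_surjective (Submodule.topEquiv.toLinearMap) (LinearEquiv.surjective _) this
  · refine (congrArg ψ (K.complex_d_apply 0 x)).trans ?_
    change Submodule.Quotient.mk _ = _
    rw [Submodule.Quotient.mk_eq_zero]
    exact Submodule.sum_mem _ fun j _ =>
      Submodule.smul_mem_smul (K.mem_span default j) trivial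
  · obtain ⟨m, rfl⟩ := Submodule.mkQ_surjective _ q
    refine ⟨fun _ => m, ?_, rfl⟩
    have : (K.complex M).d 0 0 = 0 := (K.complex M).shape 0 0 (by simp)
    exact congrArg (fun φ => φ.hom (fun _ => m)) this

lemma serre_homology_zero_of_surjective (h : Function.Surjective ((K.A 0).act M)) :
    S ((K.complex M).homology 0) := by
  refine S.prop_of_isZero ?_
  rw [← HomologicalComplex.exactAt_iff_isZero_homology,
    HomologicalComplex.exactAt_iff' _ 1 0 0 (by simp) (by simp), ShortComplex.moduleCat_exact_iff]
  intro z _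
  obtain ⟨w, hw⟩ := h z
  exact ⟨w, (K.complex_d_apply 0 w).trans hw⟩

section Injective

variable [Module.Injective R M] (h : ∀ y : M, (∀ x ∈ l, x • y = 0) → y = 0)

include h

/-- The homotopy writes x • z as a boundary, so each x in `l` kills the obstruction Σ rᵢzᵢ to
solving the system, and torsion-freeness makes the obstruction zero. -/
lemma act_zero_surjective_of_injective : Function.Surjective ((K.A 0).act M) := by
  intro z
  refine Module.Injective.exists_act_eq _ _ fun r hr => h _ fun x hx => ?_
  obtain ⟨g, hg, -⟩ := K.homotopy x hx
  have e : x • z = (K.A 0).act M ((g 0).act M z) := by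
    rw [Matrix.act_act, hg, Matrix.act_smul_one]
  have := Matrix.sum_smul_act (K.A 0) r hr ((g 0).act M z)
  rw [← e] at this
  rw [Finset.smul_sum, ← this]
  exact Finset.sum_congr rfl fun i _ => smul_comm _ _ _

/-- The same obstruction argument applies in higher degrees: for a cycle z the term h(Az) of the
homotopy drops out, leaving x • z = A(hz). -/
lemma serre_homology_of_injective (k : ℕ) : S ((K.complex M).homology k) := by
  rcases k with _ | k
  · exact K.serre_homology_zero_of_surjective (K.act_zero_surjective_of_injective h)
  refine S.prop_of_isZero ?_
  rw [← HomologicalComplex.exactAt_iff_isZero_homology,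
    HomologicalComplex.exactAt_iff' _ (k + 2) (k + 1) k (by simp) (by simp),
    ShortComplex.moduleCat_exact_iff]
  intro (z : K.ι (k + 1) → M) hz
  replace hz : (K.A k).act M z = 0 := (K.complex_d_apply k z).symm.trans hz
  suffices ∃ w, (K.A (k + 1)).act M w = z by
    obtain ⟨w, hw⟩ := this
    exact ⟨w, (K.complex_d_apply (k + 1) w).trans hw⟩
  refine Module.Injective.exists_act_eq _ _ fun r hr => h _ fun x hx => ?_
  obtain ⟨g, -, hg⟩ := K.homotopy x hx
  have e : x • z = (K.A (k + 1)).act M ((g (k + 1)).act M z) := by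
    rw [← Matrix.act_smul_one, ← hg k, Matrix.act_add, Matrix.act_act, ← Matrix.act_act (g k), hz,
      map_zero, add_zero]
  have := Matrix.sum_smul_act (K.A (k + 1)) r hr ((g (k + 1)).act M z)
  rw [← e] at this
  rw [Finset.smul_sum, ← this]
  exact Finset.sum_congr rfl fun i _ => smul_comm _ _ _

end Injective

end KoszulData

/-! ### The extension 0 → X̄ → Z → H^1(X) → 0 -/

section TorsionQuotientSequences

variable {R : Type u} [CommRing R] (I : Ideal R) {X E Y H : Type u} [AddCommGroup X] [Module R X]
  [AddCommGroup E] [Module R E] [AddCommGroup Y] [Module R Y] [AddCommGroup H] [Module R H]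

/-- The map induced on quotients by torsion submodules. -/
def torsionQuotientMap (f : X →ₗ[R] E) : (X ⧸ idealTorsion I X) →ₗ[R] (E ⧸ idealTorsion I E) :=
  Submodule.mapQ _ _ f fun _ hx => map_mem_idealTorsion f hx

lemma torsionQuotientMap_surjective {f : X →ₗ[R] E} (hf : Function.Surjective f) :
    Function.Surjective (torsionQuotientMap I f) := by
  intro y
  obtain ⟨y, rfl⟩ := Submodule.mkQ_surjective _ y
  obtain ⟨x, rfl⟩ := hf y
  exact ⟨Submodule.Quotient.mk x, rfl⟩

/-- Given `0 → X → E → Y → 0` and a presentation `Γ(E) → Γ(Y) → H → 0`, the kernel `Z` of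
`E ⧸ Γ(E) → Y ⧸ Γ(Y)` is an extension of `H` by `X ⧸ Γ(X)`. -/
lemma exists_extension_of_torsionQuotients {f : X →ₗ[R] E} {g : E →ₗ[R] Y}
    (hf : Function.Injective f) (hfg : Function.Exact f g) (hg : Function.Surjective g)
    (p : idealTorsion I Y →ₗ[R] H) (hp : Function.Surjective p)
    (hker : ∀ y, p y = 0 ↔ ∃ e ∈ idealTorsion I E, g e = y) :
    ∃ (a : (X ⧸ idealTorsion I X) →ₗ[R] LinearMap.ker (torsionQuotientMap I g))
      (b : LinearMap.ker (torsionQuotientMap I g) →ₗ[R] H),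
      Function.Injective a ∧ Function.Exact a b ∧ Function.Surjective b := by
  let gq := torsionQuotientMap I g
  have hmk (e : E) : (idealTorsion I E).mkQ e ∈ LinearMap.ker gq ↔ g e ∈ idealTorsion I Y := by
    change Submodule.Quotient.mk (g e) = 0 ↔ _
    exact Submodule.Quotient.mk_eq_zero _
  let W := (idealTorsion I Y).comap g
  let π : W →ₗ[R] LinearMap.ker gq :=
    ((idealTorsion I E).mkQ ∘ₗ W.subtype).codRestrict _ fun w => (hmk w.1).2 w.2
  have hπ : Function.Surjective π := by
    rintro ⟨z, hz⟩
    obtain ⟨e, rfl⟩ := Submodule.mkQ_surjective _ z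
    exact ⟨⟨e, (hmk e).1 hz⟩, rfl⟩
  let q : W →ₗ[R] H := p ∘ₗ g.restrict (p := W) (q := idealTorsion I Y) fun _ h => h
  have hq (w : W) : q w = 0 ↔ ∃ e ∈ idealTorsion I E, g e = g w.1 := hker _
  have hπq : LinearMap.ker π ≤ LinearMap.ker q := fun w hw => (hq w).2
    ⟨w.1, (Submodule.Quotient.mk_eq_zero _).1 (congrArg Subtype.val hw), rfl⟩
  -- The class of e goes to p(g e); this is well defined because p kills the image of Γ(E).
  let b : LinearMap.ker gq →ₗ[R] H :=
    (LinearMap.ker π).liftQ q hπq ∘ₗ (π.quotKerEquivOfSurjective hπ).symm.toLinearMap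
  have hb (w : W) : b (π w) = q w := by
    have : (π.quotKerEquivOfSurjective hπ).symm (π w) = Submodule.Quotient.mk w := by
      rw [LinearEquiv.symm_apply_eq]; rfl
    change (LinearMap.ker π).liftQ q hπq ((π.quotKerEquivOfSurjective hπ).symm (π w)) = _
    rw [this]
    rfl
  let a : (X ⧸ idealTorsion I X) →ₗ[R] LinearMap.ker gq :=
    (torsionQuotientMap I f).codRestrict _ fun x => by
      obtain ⟨x, rfl⟩ := Submodule.mkQ_surjective _ x
      refine (hmk (f x)).2 ?_
      rw [hfg.apply_apply_eq_zero]
      exact zero_mem _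
  refine ⟨a, b, ?_, ?_, ?_⟩
  · rw [injective_iff_map_eq_zero]
    intro x hx
    obtain ⟨x, rfl⟩ := Submodule.mkQ_surjective _ x
    obtain ⟨k, hk⟩ : f x ∈ idealTorsion I E :=
      (Submodule.Quotient.mk_eq_zero _).1 (congrArg Subtype.val hx)
    refine (Submodule.Quotient.mk_eq_zero _).2 ⟨k, fun r hr => hf ?_⟩
    rw [map_smul, hk r hr, map_zero]
  · intro z
    obtain ⟨w, rfl⟩ := hπ z
    rw [hb, hq]
    constructor
    · rintro ⟨e, he, hew⟩
      obtain ⟨x, hx⟩ := (hfg (w.1 - e)).1 (by rw [map_sub, hew, sub_self])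
      refine ⟨Submodule.Quotient.mk x, Subtype.ext ?_⟩
      change Submodule.Quotient.mk (f x) = Submodule.Quotient.mk w.1
      rw [hx, Submodule.Quotient.eq]
      simpa using he
    · rintro ⟨x, hx⟩
      obtain ⟨x, rfl⟩ := Submodule.mkQ_surjective _ x
      have : f x - w.1 ∈ idealTorsion I E :=
        (Submodule.Quotient.eq _).1 (congrArg Subtype.val hx)
      refine ⟨w.1 - f x, by simpa using neg_mem this, ?_⟩
      rw [map_sub, hfg.apply_apply_eq_zero, sub_zero]
  · intro h
    obtain ⟨⟨y, hy⟩, rfl⟩ := hp h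
    obtain ⟨e, rfl⟩ := hg y
    exact ⟨π ⟨e, hy⟩, hb _⟩

end TorsionQuotientSequences

/-! ### Koszul homology of the top local cohomology by dimension shifting -/

section Descent

/-- A short exact sequence embedding a module into an injective one. -/
lemma exists_shortExact_injective {R : Type u} [CommRing R] (X : ModuleCat.{u} R) :
    ∃ T : ShortComplex (ModuleCat.{u} R), T.ShortExact ∧ Injective T.X₂ ∧ T.X₁ = X :=
  ⟨ShortComplex.mk (Injective.ι X) (Limits.cokernel.π (Injective.ι X))
      (Limits.cokernel.condition _),
    { exact := ShortComplex.exact_cokernel _ }, Injective.injective_under X, rfl⟩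

variable {R : Type u} [CommRing R] [IsNoetherianRing R] (I : Ideal R)
  {S : ObjectProperty (ModuleCat.{u} R)} [S.IsSerreClass] {l : List R} (K : KoszulData l) {t : ℕ}
  (hl : Ideal.span {x | x ∈ l} = I ^ t)

include hl in
lemma torsionFree_of_list {M : Type*} [AddCommGroup M] [Module R M] (y : M ⧸ idealTorsion I M)
    (h : ∀ x ∈ l, x • y = 0) : y = 0 := by
  refine quotient_idealTorsion_torsionFree I t y fun r hr => ?_
  rw [← hl] at hr
  have : Ideal.span {x | x ∈ l} ≤ LinearMap.ker (LinearMap.toSpanSingleton R _ y) :=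
    Ideal.span_le.2 h
  exact this hr

include hl

variable {T : ShortComplex (ModuleCat.{u} R)} (hT : T.ShortExact) [Injective T.X₂]

lemma serre_koszul_torsionQuotient (k : ℕ) :
    S ((K.complex (T.X₂ ⧸ idealTorsion I T.X₂)).homology k) := by
  have : Module.Injective R T.X₂ := Module.injective_module_of_injective_object R T.X₂
  exact K.serre_homology_of_injective (torsionFree_of_list I hl) k

include hT

/-- Ȳ is a quotient of Ē, and surjectivity of the lowest differential passes to quotients. This is
what n > 1 buys for Tor. -/
lemma serre_koszul_zero_torsionQuotient :
    S ((K.complex (T.X₃ ⧸ idealTorsion I T.X₃)).homology 0) := by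
  have : Module.Injective R T.X₂ := Module.injective_module_of_injective_object R T.X₂
  refine K.serre_homology_zero_of_surjective fun z => ?_
  let g := torsionQuotientMap I T.g.hom
  have hg : Function.Surjective g := torsionQuotientMap_surjective I hT.moduleCat_surjective_g
  choose z' hz' using fun i => hg (z i)
  obtain ⟨w, hw⟩ := K.act_zero_surjective_of_injective (torsionFree_of_list I hl) z'
  refine ⟨fun j => g (w j), ?_⟩
  rw [Matrix.act_map, hw]
  exact funext hz'

/-- Existence of the module of cycles `Z`, an extension of the first local cohomology, together with
its Koszul homology. -/
lemma exists_cycles {H : ModuleCat.{u} R} (e : H ≅ (localCohomology I 1).obj T.X₁) :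
    ∃ (Z : ModuleCat.{u} R) (a : (T.X₁ ⧸ idealTorsion I T.X₁) →ₗ[R] Z) (b : Z →ₗ[R] H),
      Function.Injective a ∧ Function.Exact a b ∧ Function.Surjective b ∧
      ∀ k, S ((K.complex (T.X₃ ⧸ idealTorsion I T.X₃)).homology (k + 1)) →
        S ((K.complex Z).homology k) := by
  have hf := hT.moduleCat_injective_f
  have hg := hT.moduleCat_surjective_g
  have hfg : Function.Exact T.f.hom T.g.hom :=
    (ShortComplex.ShortExact.moduleCat_exact_iff_function_exact T).1 hT.exact
  obtain ⟨p, hp, hker⟩ := exists_idealTorsion_to_localCohomology_one I hT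
  obtain ⟨a, b, ha, hab, hb⟩ := exists_extension_of_torsionQuotients I hf hfg hg
    (e.symm.toLinearEquiv.toLinearMap ∘ₗ p) (e.symm.toLinearEquiv.surjective.comp hp)
    fun y => by
      rw [LinearMap.comp_apply, LinearEquiv.coe_coe, LinearEquiv.map_eq_zero_iff]
      exact hker y
  refine ⟨ModuleCat.of R (LinearMap.ker (torsionQuotientMap I T.g.hom)), a, b, ha, hab, hb,
    fun k hY => ?_⟩
  -- In the sequence of 0 → Z → Ē → Ȳ → 0, H_k(Z) lies between H_{k+1}(Ȳ) and H_k(Ē).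
  exact K.serre_homology_left (f := (LinearMap.ker (torsionQuotientMap I T.g.hom)).subtype)
    Subtype.val_injective (LinearMap.exact_subtype_ker_map _)
    (torsionQuotientMap_surjective I hg) hY (serre_koszul_torsionQuotient I K hl k)

omit hT in
/-- If all local cohomology modules of `X` in positive degrees belong to `S`, so does the Koszul
homology of `X ⧸ Γ(X)`. -/
lemma serre_koszul_of_localCohomology (d k : ℕ) (hd : l.length < k + d) (X : ModuleCat.{u} R)
    (hX : ∀ i, S ((localCohomology I (i + 1)).obj X)) :
    S ((K.complex (X ⧸ idealTorsion I X)).homology k) := by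
  -- Each passage from X to Y raises k by one and lowers d by one, so the bound is preserved; at d =
  -- 0 the degree exceeds the length of the complex.
  induction d generalizing k X with
  | zero => exact K.serre_homology_of_length_lt hd
  | succ d ih =>
    obtain ⟨T, hT, hI, rfl⟩ := exists_shortExact_injective X
    have hY : S ((K.complex (T.X₃ ⧸ idealTorsion I T.X₃)).homology (k + 1)) := by
      refine ih (k + 1) (by omega) T.X₃ fun i => ?_
      obtain ⟨e⟩ := localCohomology_succ_iso I hT i
      exact (S.prop_iff_of_iso e).1 (hX (i + 1))
    obtain ⟨Z, a, b, ha, hab, hb, hZ⟩ := exists_cycles (S := S) I K hl hT (Iso.refl _)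
    exact K.serre_homology_left ha hab hb (K.serre_homology_of_serre (hX 0) (k + 1)) (hZ k hY)

omit hT in
-- `H` is tied to X only through `e`, so it stays fixed while X is replaced by cosyzygies. The
-- alternative on H_0 is needed only at m = 0; after one shift it holds automatically.
lemma serre_of_localCohomology (m : ℕ) (X H : ModuleCat.{u} R)
    (e : H ≅ (localCohomology I (m + 1)).obj X)
    (hX : ∀ i, m + 1 < i → S ((localCohomology I i).obj X)) :
    S (ModuleCat.of R (H ⧸ (I ^ t • ⊤ : Submodule R H))) ∧
      (0 < m ∨ S ((K.complex (X ⧸ idealTorsion I X)).homology 0) →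
        S ((K.complex H).homology 1)) := by
  induction m generalizing X with
  | zero =>
    obtain ⟨T, hT, hI, rfl⟩ := exists_shortExact_injective X
    obtain ⟨Z, a, b, ha, hab, hb, hZ⟩ := exists_cycles (S := S) I K hl hT e
    have hY (k : ℕ) : S ((K.complex (T.X₃ ⧸ idealTorsion I T.X₃)).homology (k + 1)) := by
      refine serre_koszul_of_localCohomology I K hl (l.length + 1) _ (by omega) _ fun i => ?_
      obtain ⟨e⟩ := localCohomology_succ_iso I hT i
      exact (S.prop_iff_of_iso e).1 (hX _ (by omega))
    constructor
    · have := K.serre_quotient_of_homology_zero (hZ 0 (hY 0))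
      rw [hl] at this
      refine serre_of_surjective (Submodule.mapQ _ (I ^ t • ⊤ : Submodule R H) b ?_) ?_ this
      · rw [← Submodule.map_le_iff_le_comap, Submodule.map_smul'']
        exact Submodule.smul_mono le_rfl le_top
      · intro y
        obtain ⟨y, rfl⟩ := Submodule.mkQ_surjective _ y
        obtain ⟨x, rfl⟩ := hb y
        exact ⟨Submodule.Quotient.mk x, rfl⟩
    · intro h
      -- H_1(H) lies between H_1(Z) and H_0(X̄).
      exact K.serre_homology_right ha hab hb (hZ 1 (hY 1)) (h.resolve_left (lt_irrefl 0))
  | succ m ih =>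
    obtain ⟨T, hT, hI, rfl⟩ := exists_shortExact_injective X
    obtain ⟨e'⟩ := localCohomology_succ_iso I hT m
    obtain ⟨h0, h1⟩ := ih T.X₃ (e ≪≫ e') fun i hi => by
      obtain ⟨i, rfl⟩ : ∃ j, i = j + 1 := ⟨i - 1, by omega⟩
      obtain ⟨e''⟩ := localCohomology_succ_iso I hT i
      exact (S.prop_iff_of_iso e'').1 (hX _ (by omega))
    exact ⟨h0, fun _ => h1 (Or.inr (serre_koszul_zero_torsionQuotient I K hl hT))⟩

end Descent

/-! ### Tensor products and kernels of tensored presentations -/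

section TensorProduct

variable {R : Type u} [CommRing R] {S : ObjectProperty (ModuleCat.{u} R)} [S.IsSerreClass]
  {c : Ideal R} {N H : Type u} [AddCommGroup N] [Module R N] [AddCommGroup H] [Module R H]

/-- Quotients of `N ⊗ H` annihilated by `c` belong to `S` if `H ⧸ c H` does. -/
lemma serre_quotient_tensor [Module.Finite R N]
    (hH : S (ModuleCat.of R (H ⧸ (c • ⊤ : Submodule R H)))) {Q : Type u} [AddCommGroup Q]
    [Module R Q] (q : N ⊗[R] H →ₗ[R] Q) (hq : Function.Surjective q)
    (hc : ∀ r ∈ c, ∀ x : Q, r • x = 0) : S (ModuleCat.of R Q) := by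
  obtain ⟨m, f, hf⟩ := Module.Finite.exists_fin' R N
  have hle (g : H →ₗ[R] Q) : (c • ⊤ : Submodule R H) ≤ LinearMap.ker g :=
    Submodule.smul_le.2 fun r hr x _ => by rw [LinearMap.mem_ker, map_smul, hc r hr]
  let g (i : Fin m) : H →ₗ[R] Q := q ∘ₗ TensorProduct.mk R N H (f (Pi.single i 1))
  -- The i-th component sends h to the image of nᵢ ⊗ h, with nᵢ the i-th generator of N.
  let Φ : (Fin m → (H ⧸ (c • ⊤ : Submodule R H))) →ₗ[R] Q :=
    ∑ i, (c • ⊤ : Submodule R H).liftQ (g i) (hle _) ∘ₗ LinearMap.proj i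
  refine serre_of_surjective Φ ?_ (serre_pi m hH)
  rw [← LinearMap.range_eq_top, eq_top_iff]
  intro x _
  obtain ⟨x, rfl⟩ := hq x
  induction x with
  | zero => rw [map_zero]; exact zero_mem _
  | add x y hx hy => rw [map_add]; exact add_mem (hx trivial) (hy trivial)
  | tmul n h =>
    obtain ⟨r, rfl⟩ := hf n
    refine ⟨fun i => r i • Submodule.Quotient.mk h, ?_⟩
    conv_rhs => rw [pi_eq_sum_univ' r]
    simp only [Φ, g, LinearMap.sum_apply, LinearMap.comp_apply, LinearMap.proj_apply, map_smul,
      Submodule.liftQ_apply, TensorProduct.mk_apply, map_sum, TensorProduct.sum_tmul,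
      ← TensorProduct.smul_tmul']

/-- The kernel of `g ⊗ H`. -/
def tensorKer {A B : Type u} [AddCommGroup A] [Module R A] [AddCommGroup B] [Module R B]
    (g : A →ₗ[R] B) (H : Type u) [AddCommGroup H] [Module R H] : Submodule R (A ⊗[R] H) :=
  LinearMap.ker (g.rTensor H)

section Presentation

variable {F : Type u} [AddCommGroup F] [Module R F] {m : ℕ} (b : Module.Basis (Fin m) R F)
  (f : F →ₗ[R] N) (hc : ∀ r ∈ c, ∀ x : N, r • x = 0)

/-- Multiplication of a basis element with elements of an ideal annihilating the quotient. -/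
noncomputable def idealToKer (i : Fin m) : c →ₗ[R] LinearMap.ker f :=
  (LinearMap.toSpanSingleton R F (b i) ∘ₗ Submodule.subtype c).codRestrict _ fun r => by
    rw [LinearMap.mem_ker, LinearMap.comp_apply, LinearMap.toSpanSingleton_apply, map_smul]
    exact hc r r.2 _

include b hc in
-- Put L = ker f, which contains cF ≅ c^m. Exactness of Tor_1(R/c, H)^m → Tor_1(N, H) → (L/cF) ⊗ H
-- is checked by hand: `G` is the map (c ⊗ H)^m → L ⊗ H, and its cokernel is killed by c.
lemma serre_tensorKer_of_basis [IsNoetherianRing R]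
    (hH : S (ModuleCat.of R (H ⧸ (c • ⊤ : Submodule R H))))
    (hc₁ : S (ModuleCat.of R (tensorKer (Submodule.subtype c) H))) :
    S (ModuleCat.of R (tensorKer (LinearMap.ker f).subtype H)) := by
  have : Module.Finite R F := Module.Finite.of_basis b
  let i := (LinearMap.ker f).subtype
  let G : (Fin m → c ⊗[R] H) →ₗ[R] LinearMap.ker f ⊗[R] H :=
    ∑ j, (idealToKer b f hc j).rTensor H ∘ₗ LinearMap.proj j
  have hi (j : Fin m) : i ∘ₗ idealToKer b f hc j =
    LinearMap.toSpanSingleton R F (b j) ∘ₗ Submodule.subtype c := rfl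
  have hiG (s : Fin m → c ⊗[R] H) : i.rTensor H (G s) =
      ∑ j, (LinearMap.toSpanSingleton R F (b j)).rTensor H
        ((Submodule.subtype c).rTensor H (s j)) := by
    simp only [G, LinearMap.sum_apply, LinearMap.comp_apply, LinearMap.proj_apply, map_sum]
    refine Finset.sum_congr rfl fun j _ => ?_
    rw [← LinearMap.comp_apply, ← LinearMap.rTensor_comp, hi, LinearMap.rTensor_comp,
      LinearMap.comp_apply]
  -- The coordinates of F separate the m summands, so G s dies in F ⊗ H only if each s k dies in R ⊗
  -- H.
  have hcoord (s : Fin m → c ⊗[R] H) (k : Fin m) : (b.coord k).rTensor H (i.rTensor H (G s)) =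
      (Submodule.subtype c).rTensor H (s k) := by
    have e (j : Fin m) : b.coord k ∘ₗ LinearMap.toSpanSingleton R F (b j) =
        if j = k then LinearMap.id else 0 := by
      ext
      simp only [LinearMap.comp_apply, LinearMap.toSpanSingleton_apply, one_smul,
        Module.Basis.coord_apply, Module.Basis.repr_self, Finsupp.single_apply]
      split_ifs <;> rfl
    rw [hiG, map_sum]
    simp_rw [← LinearMap.comp_apply (LinearMap.rTensor H (b.coord k)), ← LinearMap.rTensor_comp, e]
    rw [Finset.sum_eq_single k (fun j _ hj => by simp [hj]) (by simp)]
    simp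
  have hG (s : Fin m → c ⊗[R] H) : i.rTensor H (G s) = 0 ↔
      ∀ j, s j ∈ tensorKer (Submodule.subtype c) H := by
    constructor
    · intro h j
      rw [tensorKer, LinearMap.mem_ker, ← hcoord, h, map_zero]
    · intro h
      rw [hiG]
      exact Finset.sum_eq_zero fun j _ => (congrArg _
        (show (Submodule.subtype c).rTensor H (s j) = 0 from h j)).trans (map_zero _)
  let α : (Fin m → tensorKer (Submodule.subtype c) H) →ₗ[R] tensorKer i H :=
    (G ∘ₗ (tensorKer (Submodule.subtype c) H).subtype.compLeft (Fin m)).codRestrict _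
      fun s => (hG _).2 fun j => (s j).2
  let β : tensorKer i H →ₗ[R] (LinearMap.ker f ⊗[R] H) ⧸ LinearMap.range G :=
    (LinearMap.range G).mkQ ∘ₗ (tensorKer i H).subtype
  refine serre_of_exact α β (fun x => ?_) (serre_pi m hc₁)
    (serre_quotient_tensor (c := c) hH (LinearMap.range G).mkQ (Submodule.mkQ_surjective _) ?_)
  · constructor
    · intro hx
      obtain ⟨s, hs⟩ : x.1 ∈ LinearMap.range G := (Submodule.Quotient.mk_eq_zero _).1 hx
      have h0 : i.rTensor H (G s) = 0 := by rw [hs]; exact x.2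
      exact ⟨fun j => ⟨s j, (hG s).1 h0 j⟩, Subtype.ext hs⟩
    · rintro ⟨s, rfl⟩
      exact (Submodule.Quotient.mk_eq_zero _).2 ⟨_, rfl⟩
  · intro r hr x
    obtain ⟨x, rfl⟩ := Submodule.mkQ_surjective _ x
    rw [← map_smul, Submodule.mkQ_apply, Submodule.Quotient.mk_eq_zero]
    induction x with
    | zero => rw [smul_zero]; exact zero_mem _
    | add x y hx hy => rw [smul_add]; exact add_mem hx hy
    | tmul n h =>
      refine ⟨fun j => (⟨b.repr n.1 j * r, c.mul_mem_left _ hr⟩ : c) ⊗ₜ h, ?_⟩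
      simp only [G, LinearMap.sum_apply, LinearMap.comp_apply, LinearMap.proj_apply,
        LinearMap.rTensor_tmul, TensorProduct.smul_tmul', ← TensorProduct.sum_tmul]
      congr 1
      refine Subtype.ext ?_
      rw [AddSubmonoidClass.coe_finsetSum]
      change ∑ j, (b.repr n.1 j * r) • b j = r • n.1
      conv_rhs => rw [← b.sum_repr n.1, Finset.smul_sum]
      exact Finset.sum_congr rfl fun j _ => by rw [smul_smul, mul_comm]

end Presentation

/-- The kernel of `c ⊗ H → H` is a quotient of Koszul homology. -/
lemma serre_tensorKer_of_koszul {l : List R} (K : KoszulData l)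
    (hl : Ideal.span {x | x ∈ l} = c) (h : S ((K.complex H).homology 1)) :
    S (ModuleCat.of R (tensorKer (Submodule.subtype c) H)) := by
  have := K.unique
  let a (j : K.ι 1) : c := ⟨K.A 0 default j, hl ▸ K.mem_span default j⟩
  let ψ : (K.ι 1 → H) →ₗ[R] c ⊗[R] H :=
    ∑ j, TensorProduct.mk R c H (a j) ∘ₗ LinearMap.proj j
  have hψ (z) : ψ z = ∑ j, a j ⊗ₜ[R] z j := by simp [ψ]
  refine K.serre_of_homology_one ψ (fun w => ?_) _ (fun q hq => ?_) h
  · rw [hψ]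
    simp_rw [Matrix.act_apply, TensorProduct.tmul_sum, ← TensorProduct.smul_tmul]
    rw [Finset.sum_comm]
    simp_rw [← TensorProduct.sum_tmul]
    refine Finset.sum_eq_zero fun k _ => ?_
    convert TensorProduct.zero_tmul c (w k)
    refine Subtype.ext ?_
    rw [AddSubmonoidClass.coe_finsetSum]
    have := congrFun (congrFun (K.mul_eq_zero 0) default) k
    rw [Matrix.mul_apply] at this
    refine (Finset.sum_congr rfl fun j _ => ?_).trans this
    exact mul_comm _ _
  · have hsurj (q : c ⊗[R] H) : ∃ z, ψ z = q := by
      rw [← LinearMap.mem_range]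
      induction q with
      | zero => exact zero_mem _
      | add x y hx hy => exact add_mem hx hy
      | tmul r h =>
        -- The entries of the lowest differential generate c: the homotopy for x in `l` expresses x
        -- as a combination of them.
        obtain ⟨u, hu⟩ : ∃ u : K.ι 1 → R, ∑ j, u j * K.A 0 default j = r.1 := by
          suffices c ≤ LinearMap.range (Fintype.linearCombination R fun j => K.A 0 default j) from
            this r.2
          rw [← hl]
          refine Ideal.span_le.2 fun x hx => ?_
          obtain ⟨s, hs, -⟩ := K.homotopy x hx
          refine ⟨fun j => s 0 j default, ?_⟩
          have := congrFun (congrFun hs default) default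
          rw [Matrix.mul_apply, Matrix.smul_apply, Matrix.one_apply_eq, smul_eq_mul, mul_one]
            at this
          rw [Fintype.linearCombination_apply, ← this]
          exact Finset.sum_congr rfl fun j _ => mul_comm _ _
        refine ⟨fun j => u j • h, ?_⟩
        rw [hψ]
        simp_rw [← TensorProduct.smul_tmul, ← TensorProduct.sum_tmul]
        congr 1
        refine Subtype.ext ?_
        rw [AddSubmonoidClass.coe_finsetSum]
        exact hu
    obtain ⟨z, rfl⟩ := hsurj q
    refine ⟨z, funext fun i => ?_, rfl⟩
    obtain rfl := Subsingleton.elim i default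
    have hz : (Submodule.subtype c).rTensor H (ψ z) = 0 := hq
    have := congrArg (TensorProduct.lid R H) hz
    simpa [hψ, a, Matrix.act_apply] using this

/-- A dimension shifting argument with two presentations of `N`. -/
lemma exact_of_two_presentations {P₀ P₁ P₂ F : Type u} [AddCommGroup P₀] [Module R P₀]
    [AddCommGroup P₁] [Module R P₁] [AddCommGroup P₂] [Module R P₂] [AddCommGroup F] [Module R F]
    [Module.Projective R P₀] [Module.Projective R F] (d₂ : P₂ →ₗ[R] P₁) (d₁ : P₁ →ₗ[R] P₀)
    (π : P₀ →ₗ[R] N) (h₁ : Function.Exact d₂ d₁) (h₀ : Function.Exact d₁ π)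
    (hπ : Function.Surjective π) (f : F →ₗ[R] N) (hf : Function.Surjective f) :
    ∃ ψ : P₁ →ₗ[R] LinearMap.ker f,
      (∀ x, d₁.rTensor H x = 0 → (LinearMap.ker f).subtype.rTensor H (ψ.rTensor H x) = 0) ∧
      ∀ x, d₁.rTensor H x = 0 → ψ.rTensor H x = 0 → ∃ y, d₂.rTensor H y = x := by
  obtain ⟨φ, hφ⟩ := Module.projective_lifting_property f π hf
  obtain ⟨χ, hχ⟩ := Module.projective_lifting_property π f hπ
  have hφ' (x) : f (φ x) = π x := LinearMap.congr_fun hφ x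
  have hχ' (x) : π (χ x) = f x := LinearMap.congr_fun hχ x
  let δ : P₁ →ₗ[R] LinearMap.ker π := d₁.codRestrict _ fun x => h₀.apply_apply_eq_zero x
  let φ' : LinearMap.ker π →ₗ[R] LinearMap.ker f := φ.restrict fun x hx => by
    rw [LinearMap.mem_ker, hφ', hx]
  let χ' : LinearMap.ker f →ₗ[R] LinearMap.ker π := χ.restrict fun x hx => by
    rw [LinearMap.mem_ker, hχ', hx]
  -- Since π χ φ = π, the difference χφ - id lands in ker π. On ker π this makes χ'φ' the identity
  -- up to a map factoring through P₀, which vanishes on elements that die in P₀ ⊗ H; so φ' ⊗ H is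
  -- injective on those.
  let θ : P₀ →ₗ[R] LinearMap.ker π := (χ ∘ₗ φ - LinearMap.id).codRestrict _ fun x => by
    simp [hχ', hφ']
  have e₁ : (LinearMap.ker π).subtype ∘ₗ δ = d₁ := rfl
  have e₂ : χ' ∘ₗ φ' = LinearMap.id + θ ∘ₗ (LinearMap.ker π).subtype := by
    ext x
    simp [χ', φ', θ]
  have e₃ : (LinearMap.ker f).subtype ∘ₗ φ' ∘ₗ δ = φ ∘ₗ d₁ := rfl
  have hδ : Function.Surjective δ := by
    rintro ⟨x, hx⟩
    obtain ⟨y, rfl⟩ := (h₀ x).1 hx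
    exact ⟨y, rfl⟩
  have hδ' : Function.Exact d₂ δ := fun x => by
    rw [← h₁ x]
    exact Subtype.ext_iff
  refine ⟨φ' ∘ₗ δ, fun x hx => ?_, fun x hx hx' => ?_⟩
  · rw [← LinearMap.comp_apply, ← LinearMap.rTensor_comp, e₃, LinearMap.rTensor_comp,
      LinearMap.comp_apply, hx, map_zero]
  · refine (rTensor_exact H hδ' hδ x).1 ?_
    rw [← e₁, LinearMap.rTensor_comp, LinearMap.comp_apply] at hx
    rw [LinearMap.rTensor_comp, LinearMap.comp_apply] at hx'
    have := congrArg (χ'.rTensor H) hx'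
    rw [← LinearMap.comp_apply, ← LinearMap.rTensor_comp, e₂, map_zero, LinearMap.rTensor_add,
      LinearMap.add_apply, LinearMap.rTensor_comp, LinearMap.comp_apply, hx, map_zero, add_zero,
      LinearMap.rTensor_id, LinearMap.id_apply] at this
    exact this

end TensorProduct

/-! ### Tor_1 from an arbitrary projective presentation -/

section Tor

variable {R : Type u} [CommRing R] {S : ObjectProperty (ModuleCat.{u} R)} [S.IsSerreClass]

/-- Comparing a projective resolution of N with the given presentation embeds Tor_1 in the kernel of
ker f ⊗ H → F ⊗ H; an embedding is enough for a Serre class. -/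
lemma serre_tor_one (N H : ModuleCat.{u} R) {F : Type u} [AddCommGroup F] [Module R F]
    [Module.Projective R F] (f : F →ₗ[R] N)
    (hf : Function.Surjective f)
    (h : S (ModuleCat.of R (tensorKer (LinearMap.ker f).subtype H))) :
    S (((Tor' (ModuleCat.{u} R) 1).obj N).obj H) := by
  let P := projectiveResolution N
  let C := (((MonoidalCategory.tensoringRight (ModuleCat.{u} R)).obj H).mapHomologicalComplex
    (ComplexShape.down ℕ)).obj P.complex
  suffices S (C.sc' 2 1 0).homology from
    (S.prop_iff_of_iso (P.isoLeftDerivedObj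
      ((MonoidalCategory.tensoringRight (ModuleCat.{u} R)).obj H) 1 ≪≫
      C.homologyIsoSc' 2 1 0 (by simp) (by simp))).2 this
  have : Module.Projective R (P.complex.X 0) :=
    (IsProjective.iff_projective _).2 (P.projective 0)
  have h₁ : Function.Exact (P.complex.d 2 1).hom (P.complex.d 1 0).hom :=
    (ShortComplex.ShortExact.moduleCat_exact_iff_function_exact _).1 (P.exact_succ 0)
  have h₀ : Function.Exact (P.complex.d 1 0).hom (P.π.f 0).hom :=
    (ShortComplex.ShortExact.moduleCat_exact_iff_function_exact _).1 P.exact₀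
  have hπ : Function.Surjective (P.π.f 0).hom := (ModuleCat.epi_iff_surjective _).1 inferInstance
  obtain ⟨ψ, hψ, hψ'⟩ := exact_of_two_presentations (N := N) (H := H) _ _ _ h₁ h₀ hπ f hf
  exact serre_homology (C.sc' 2 1 0) (ψ.rTensor H) (tensorKer (LinearMap.ker f).subtype H) hψ hψ' h

end Tor

lemma IsIdealTorsion.exists_pow {R : Type*} [CommRing R] {I : Ideal R} {M : Type*} [AddCommGroup M]
    [Module R M] [Module.Finite R M] (hM : IsIdealTorsion I M) :
    ∃ k, ∀ r ∈ I ^ k, ∀ x : M, r • x = 0 := by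
  obtain ⟨k, hk⟩ := exists_pow_smul_eq_zero_of_fg I (Module.Finite.fg_top (R := R) (M := M))
    (fun x _ => hM x)
  exact ⟨k, fun r hr x => hk r hr x trivial⟩

lemma Ideal.exists_list_span {R : Type*} [CommRing R] [IsNoetherianRing R] (I : Ideal R) :
    ∃ l : List R, Ideal.span {x | x ∈ l} = I := by
  obtain ⟨s, hs⟩ := IsNoetherian.noetherian I
  refine ⟨s.toList, ?_⟩
  simpa using hs

/-! ### Conclusion for H^n -/

section TopDegree

variable {R : Type u} [CommRing R] [IsNoetherianRing R] {S : ObjectProperty (ModuleCat.{u} R)}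
  [S.IsSerreClass] {I : Ideal R} {X : ModuleCat.{u} R} {n : ℕ}
  (hS : ∀ i : ℕ, n < i → S ((localCohomology I i).obj X))

include hS

lemma serre_localCohomology_quotient_pow (hn : 0 < n) (t : ℕ) :
    S (ModuleCat.of R ((localCohomology I n).obj X ⧸
      (I ^ t • ⊤ : Submodule R ((localCohomology I n).obj X)))) := by
  obtain ⟨m, rfl⟩ := Nat.exists_eq_succ_of_ne_zero hn.ne'
  obtain ⟨l, hl⟩ := (I ^ t).exists_list_span
  exact (serre_of_localCohomology I (KoszulData.ofList l) hl m X _ (Iso.refl _) hS).1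

lemma serre_tor_one_localCohomology (hn : 1 < n) (N : ModuleCat.{u} R) [Module.Finite R N]
    (hN : IsIdealTorsion I N) :
    S (((Tor' (ModuleCat.{u} R) 1).obj N).obj ((localCohomology I n).obj X)) := by
  obtain ⟨t, ht⟩ := hN.exists_pow
  obtain ⟨l, hl⟩ := (I ^ t).exists_list_span
  obtain ⟨m, f, hf⟩ := Module.Finite.exists_fin' R N
  have hH := serre_localCohomology_quotient_pow hS (by omega) t
  obtain ⟨k, rfl⟩ : ∃ k, n = k + 1 := ⟨n - 1, by omega⟩
  have h₁ := (serre_of_localCohomology I (KoszulData.ofList l) hl k X _ (Iso.refl _) hS).2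
    (Or.inl (by omega))
  exact serre_tor_one N _ f hf (serre_tensorKer_of_basis (Pi.basisFun R (Fin m)) f ht hH
    (serre_tensorKer_of_koszul _ hl h₁))

end TopDegree

theorem corollary3p2 {R : Type u} [CommRing R] [IsNoetherianRing R] (𝔞 : Ideal R)
    (X : ModuleCat.{u} R) (S : ObjectProperty (ModuleCat.{u} R)) [S.IsSerreClass] (n : ℕ)
    (hS : ∀ i : ℕ, n < i → S ((localCohomology 𝔞 i).obj X))
    (N : ModuleCat.{u} R) [Module.Finite R N] (hN : IsIdealTorsion 𝔞 N)
    (𝔟 : Ideal R) (h𝔟 : 𝔞 ≤ 𝔟.radical) :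
    (0 < n →
      S (ModuleCat.of R (N ⊗[R] (localCohomology 𝔞 n).obj X)) ∧
      S (ModuleCat.of R ((localCohomology 𝔞 n).obj X ⧸
        (𝔟 • ⊤ : Submodule R ((localCohomology 𝔞 n).obj X))))) ∧
    (1 < n →
      S (((Tor' (ModuleCat.{u} R) 1).obj N).obj ((localCohomology 𝔞 n).obj X)) ∧
      S (((Tor' (ModuleCat.{u} R) 1).obj (ModuleCat.of R (R ⧸ 𝔟))).obj
        ((localCohomology 𝔞 n).obj X))) := by
  -- From 𝔞^t ⊆ 𝔟, the quotient H/𝔟H is a quotient of H/𝔞^tH, and R/𝔟 is 𝔞-torsion, so it can take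
  -- the place of N.
  obtain ⟨t, ht⟩ := Ideal.exists_pow_le_of_le_radical_of_fg h𝔟 (IsNoetherian.noetherian 𝔞)
  refine ⟨fun hn => ⟨?_, ?_⟩, fun hn => ⟨serre_tor_one_localCohomology hS hn N hN,
    serre_tor_one_localCohomology hS hn (ModuleCat.of R (R ⧸ 𝔟)) fun x => ⟨t, fun r hr => ?_⟩⟩⟩
  · obtain ⟨k, hk⟩ := hN.exists_pow
    refine serre_quotient_tensor (serre_localCohomology_quotient_pow hS hn k) LinearMap.id
      Function.surjective_id fun r hr x => ?_
    induction x with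
    | zero => exact smul_zero r
    | add x y hx hy => rw [smul_add, hx, hy, add_zero]
    | tmul x y => rw [TensorProduct.smul_tmul', hk r hr, TensorProduct.zero_tmul]
  · exact serre_of_surjective (Submodule.factor (Submodule.smul_mono_left ht))
      (Submodule.factor_surjective _) (serre_localCohomology_quotient_pow hS hn t)
  · obtain ⟨x, rfl⟩ := Ideal.Quotient.mk_surjective x
    exact Ideal.Quotient.eq_zero_iff_mem.2 (𝔟.mul_mem_right x (ht hr))
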